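/- **Conventions.** Let $R$ be a left noetherian ring, $S$ a right noetherian ring, and ${}_RU_S$ an $(R,S)$-bimodule such that ${}_RU$ is a generalized tilting (Wakamatsu tilting) module with $S=\mathrm{End}({}_RU)$, i.e. every $R$-endomorphism of $U$ is right multiplication by a unique element of $S$. Here ${}_RU$ is *generalized tilting* if - $U$ is finitely generated and has a resolution $\cdots\to P_1\to P_0\to U\to 0$ by finitely generated projective left $R$-modules; - $\mathrm{Ext}_R^i(U,U)=0$ for all $i\ge 1$; - there is an exact sequence $0\to R\to U_0\to U_1\to\cdots$ of left $R$-modules, each $U_i$ being a direct summand of a finite direct sum of copies of $U$, which remains exact after applying $\mathrm{Hom}_R(-,U)$. Let $0\to U\to E_0\to E_1\to\cdots$ be a minimal injective resolution of ${}_RU$. Write $\text{add-lim}\,U$ for the class of left $R$-modules that are isomorphic to direct summands of direct limits (over directed index sets) of modules each of which is a finite direct sum of copies of $U$. For a left $R$-module $A$ let $U\text{-lim.dim}(A)\in\mathbb N\cup\{\infty\}$ be the infimum of all $n\geq 0$ for which there is an exact sequence $0\to V_n\to\cdots\to V_0\to A\to 0$ with all $V_i\in\text{add-lim}\,U$ (and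 $\infty$ if there is none). For $n\ge1$ let $\mathcal E_n(U_S)$ be the class of finitely generated left $R$-modules isomorphic to $\mathrm{Ext}_S^n(N,U)$ for some finitely generated right $S$-module $N$, where the left $R$-module structure on $\mathrm{Ext}_S^n(N,U)$ is the one induced by that of $U$. A class $\mathcal X$ of finitely generated left $R$-modules is *submodule-closed* if every nonzero submodule of a module in $\mathcal X$ is in $\mathcal X$. **Proposition.** Let $n\le 2$ and assume that the injective dimensions of ${}_RU$ and $U_S$ satisfy $\mathrm{l.id}_R(U)=\mathrm{r.id}_S(U)\le n$. 1. If $n=1$, then the following are equivalent: $\mathcal E_1(U_S)$ is submodule-closed; $E_0\in\text{add-lim}\,U$ (that is, $U\text{-lim.dim}(E_0)=0$); $U\text{-lim.dim}(E_i)\le i$ for $i=0,1$. 2. If $n=2$, then $\mathcal E_2(U_S)$ is submodule-closed if and only if $U\text{-lim.dim}(E_0\oplus E_1)\le 1$. -/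

import Mathlib

open CategoryTheory CategoryTheory.Abelian

universe u

noncomputable section

namespace WakamatsuTilting

section LeftModules

variable (R : Type u) [Ring R] (U : Type u) [AddCommGroup U] [Module R U]

/-- `X` is a finitely generated left `R`-module having a resolution
`⋯ → P₁ → P₀ → X → 0` by finitely generated projective modules. -/
def GenStar (X : Type u) [AddCommGroup X] [Module R X] : Prop :=
  Module.Finite R X ∧
  ∃ (P : ℕ → ModuleCat.{u} R) (d : ∀ i, P (i + 1) →ₗ[R] P i) (ε : P 0 →ₗ[R] X),
    (∀ i, Module.Finite R (P i) ∧ Module.Projective R (P i)) ∧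
    Function.Surjective ε ∧ Function.Exact (d 0) ε ∧
    ∀ i, Function.Exact (d (i + 1)) (d i)

/-- `Ext_R^i(U, U) = 0` for all `i ≥ 1`. -/
def Selforthogonal : Prop :=
  ∀ i : ℕ, 1 ≤ i → Subsingleton (Ext (ModuleCat.of R U) (ModuleCat.of R U) i)

/-- `A` is a direct summand of `B` (up to isomorphism). -/
def IsSummand (A B : Type u) [AddCommGroup A] [Module R A] [AddCommGroup B] [Module R B] : Prop :=
  ∃ (i : A →ₗ[R] B) (p : B →ₗ[R] A), p ∘ₗ i = LinearMap.id

/-- `A ∈ add U`: `A` is a direct summand of a finite direct sum of copies of `U`. -/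
def InAdd (A : Type u) [AddCommGroup A] [Module R A] : Prop :=
  ∃ k : ℕ, IsSummand R A (Fin k → U)

/-- Generalized tilting (Wakamatsu tilting) left `R`-modules. -/
def IsGeneralizedTilting : Prop :=
  Selforthogonal R U ∧ GenStar R U ∧
  ∃ (V : ℕ → ModuleCat.{u} R) (η : R →ₗ[R] V 0) (δ : ∀ i, V i →ₗ[R] V (i + 1)),
    (∀ i, InAdd R U (V i)) ∧
    -- the sequence `0 → R → V₀ → V₁ → ⋯` is exact
    Function.Injective η ∧ Function.Exact η (δ 0) ∧
    (∀ i, Function.Exact (δ i) (δ (i + 1))) ∧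
    -- and it stays exact after applying `Hom_R(-, U)`
    Function.Surjective (fun g : V 0 →ₗ[R] U => g ∘ₗ η) ∧
    Function.Exact (fun g : V 1 →ₗ[R] U => g ∘ₗ δ 0) (fun g : V 0 →ₗ[R] U => g ∘ₗ η) ∧
    ∀ i, Function.Exact (fun g : V (i + 2) →ₗ[R] U => g ∘ₗ δ (i + 1))
      (fun g : V (i + 1) →ₗ[R] U => g ∘ₗ δ i)

/-- `A ∈ add-lim U`: `A` is a direct summand of a direct limit (over a nonempty directed index set)
of modules each of which is a finite direct sum of copies of `U`. -/
def InAddLim (A : Type u) [AddCommGroup A] [Module R A] : Prop :=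
  ∃ (ι : Type u) (_ : Preorder ι) (_ : Nonempty ι) (_ : IsDirectedOrder ι) (_ : DecidableEq ι)
    (k : ι → ℕ) (f : ∀ i j, i ≤ j → (Fin (k i) → U) →ₗ[R] (Fin (k j) → U))
    (_ : DirectedSystem (fun i => Fin (k i) → U) fun i j h => f i j h),
    IsSummand R A (Module.DirectLimit (fun i => Fin (k i) → U) f)

/-- There is an exact sequence `0 → Vₙ → ⋯ → V₁ → V₀ → A → 0` with `Vᵢ ∈ add-lim U`.
The sequence is indexed by `ℕ`, the terms beyond `n` being zero. -/
def HasAddLimResolution (A : Type u) [AddCommGroup A] [Module R A] (n : ℕ) : Prop :=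
  ∃ (V : ℕ → ModuleCat.{u} R) (d : ∀ i, V (i + 1) →ₗ[R] V i) (ε : V 0 →ₗ[R] A),
    (∀ i ≤ n, InAddLim R U (V i)) ∧ (∀ i, n < i → Subsingleton (V i)) ∧
    Function.Surjective ε ∧ Function.Exact (d 0) ε ∧
    ∀ i, Function.Exact (d (i + 1)) (d i)

/-- The `U`-limit dimension of `A`: the infimum (in `ℕ∞`) of the lengths of the finite
resolutions of `A` by modules in `add-lim U`, and `⊤` if there is none. -/
def limDim (A : Type u) [AddCommGroup A] [Module R A] : ℕ∞ :=
  ⨅ (n : ℕ) (_ : HasAddLimResolution R U A n), (n : ℕ∞)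

/-- `N` is an essential submodule of `M`. -/
def IsEssential {M : Type u} [AddCommGroup M] [Module R M] (N : Submodule R M) : Prop :=
  ∀ K : Submodule R M, K ≠ ⊥ → N ⊓ K ≠ ⊥

/-- `0 → U → E₀ → E₁ → ⋯`, with augmentation `η` and differentials `α`, is a minimal injective
resolution of `U`: an injective resolution such that the image of each map
is essential in its target. -/
structure IsMinimalInjectiveResolution (E : ℕ → ModuleCat.{u} R) (η : U →ₗ[R] E 0)
    (α : ∀ i, E i →ₗ[R] E (i + 1)) : Prop where
  injective : ∀ i, Module.Injective R (E i)
  mono : Function.Injective η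
  exact_zero : Function.Exact η (α 0)
  exact_succ : ∀ i, Function.Exact (α i) (α (i + 1))
  essential_zero : IsEssential R (LinearMap.range η)
  essential_succ : ∀ i, IsEssential R (LinearMap.range (α i))

/-- A class of left `R`-modules is submodule-closed if any nonzero submodule of a module in
the class is in the class. -/
def SubmoduleClosed (X : ModuleCat.{u} R → Prop) : Prop :=
  ∀ M : ModuleCat.{u} R, X M → ∀ A : Submodule R M, A ≠ ⊥ → X (ModuleCat.of R A)

end LeftModules

section Bimodules

variable (R S : Type u) [Ring R] [Ring S] (U : Type u) [AddCommGroup U] [Module R U]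
  [Module Sᵐᵒᵖ U] [SMulCommClass R Sᵐᵒᵖ U]

/-- `S = End(_R U)`: each `R`-endomorphism of `U` is right multiplication by a
unique element of `S`. -/
def IsEndRing : Prop :=
  ∀ φ : U →ₗ[R] U, ∃! s : S, ∀ x : U, φ x = MulOpposite.op s • x

/-- Left multiplication by `r : R` as an endomorphism of the right `S`-module `U`. -/
def leftMul (r : R) : ModuleCat.of Sᵐᵒᵖ U ⟶ ModuleCat.of Sᵐᵒᵖ U :=
  ModuleCat.ofHom
    { toFun := fun x => r • x
      map_add' := smul_add r
      map_smul' := fun s x => smul_comm r s x }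

/-- `M ∈ 𝓔ₙ(U_S)`: `M` is a finitely generated left `R`-module which is isomorphic to
`Ext_S^n(N, U)` for a finitely generated right `S`-module `N`. The left `R`-module structure of
`Ext_S^n(N, U)` comes from functoriality in `U`, so the isomorphism is an additive one that
carries the action of `r` to composition with left multiplication by `r` on `U`. -/
def InE (n : ℕ) (M : ModuleCat.{u} R) : Prop :=
  Module.Finite R M ∧
  ∃ N : ModuleCat.{u} Sᵐᵒᵖ, Module.Finite Sᵐᵒᵖ N ∧
    ∃ e : M ≃+ Ext N (ModuleCat.of Sᵐᵒᵖ U) n,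
      ∀ (r : R) (m : M), e (r • m) = (e m).comp (Ext.mk₀ (leftMul R S U r)) (add_zero n)

end Bimodules

end WakamatsuTilting

end

/-! Write `X*` for `Hom(X, U)`, over either ring. The given coresolution of `R` in `add U` dualizes
to a projective resolution of `U` over `S`, and a second dualization returns the coresolution. Hence
`R` is the endomorphism ring of `U` over `S` and `Ext_S^i(U, U) = 0` for `i ≥ 1`: the hypotheses
become symmetric (`selforthogonal_and_end_of_coresolution`). Since both injective dimensions are at
most two, `Ext^i(X*, U) = 0` for `i ≥ 1` and finitely generated `X`, and `X → X**` is onto as soon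
as `Ext¹(X, U) = 0` (`extVanish_dual`, `exists_eval`).

Dualizing presentations twice then identifies the classes. If `n = 1`, `𝓔₁(U_S)` consists of the
finitely generated `M` with `Hom(M, U) = 0`. If `n = 2`, `𝓔₂(U_S)` consists of those with `Ext¹(M,
U) = 0` as well. By essentiality in the minimal resolution, such a class is submodule-closed exactly
when its members have no nonzero map to `E₀`, respectively to `E₀ ⊕ E₁`.

It remains to compare this with `add-lim U`, which consists of the modules `A` such that every map
from a finitely generated module to `A` factors through some `U^l` (`inAddLim_iff`). For `n = 1`,
the kernel of a left approximation `X → U^l` lies in the class, so a map `X → E₀` kills it and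
extends to `U^l` by injectivity. For `n = 2`, that kernel lies in the class only when `Ext¹(X, U) =
0`. A pushout supplies this condition and shows that the kernel of the evaluation map `U^(Λ) → E₀ ⊕
E₁` is in `add-lim U` (`factorsOnFinite_ker_evalSum`). Conversely, a two-term resolution of the
target kills maps from the class by a lifting argument (`hom_eq_zero_of_isSES`). -/

noncomputable section

namespace WakamatsuTilting

/-! ### Long exact sequences and dimension shifting for `Ext` -/

section ExtTools

variable {A : Type u} [Ring A]
variable {X₁ X₂ X₃ Y Y₁ Y₂ Y₃ X : Type u} [AddCommGroup X₁] [AddCommGroup X₂] [AddCommGroup X₃]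
  [AddCommGroup Y] [AddCommGroup Y₁] [AddCommGroup Y₂] [AddCommGroup Y₃] [AddCommGroup X]
  [Module A X₁] [Module A X₂] [Module A X₃] [Module A Y] [Module A Y₁] [Module A Y₂] [Module A Y₃]
  [Module A X]

/-- `Ext_A^i(X, Y) = 0`. -/
def ExtVanish (A : Type u) [Ring A] (X Y : Type u) [AddCommGroup X] [AddCommGroup Y] [Module A X]
    [Module A Y] (i : ℕ) : Prop :=
  Subsingleton (Ext (ModuleCat.of A X) (ModuleCat.of A Y) i)

theorem ExtVanish.eq_zero {i : ℕ} (h : ExtVanish A X Y i)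
    (x : Ext (ModuleCat.of A X) (ModuleCat.of A Y) i) : x = 0 :=
  @Subsingleton.elim _ h _ _

theorem ExtVanish.of_eq_zero {i : ℕ}
    (h : ∀ x : Ext (ModuleCat.of A X) (ModuleCat.of A Y) i, x = 0) : ExtVanish A X Y i :=
  ⟨fun x y => (h x).trans (h y).symm⟩

/-- `0 → X₁ → X₂ → X₃ → 0` is exact. -/
structure IsSES (f : X₁ →ₗ[A] X₂) (g : X₂ →ₗ[A] X₃) : Prop where
  inj : Function.Injective f
  exact : Function.Exact f g
  surj : Function.Surjective g

namespace IsSES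

variable {f : X₁ →ₗ[A] X₂} {g : X₂ →ₗ[A] X₃}

/-- The short complex of modules attached to a short exact sequence. -/
abbrev complex (h : IsSES f g) : ShortComplex (ModuleCat.{u} A) :=
  ShortComplex.mk (ModuleCat.ofHom f) (ModuleCat.ofHom g)
    (by rw [← ModuleCat.ofHom_comp, h.exact.linearMap_comp_eq_zero]; rfl)

theorem shortExact (h : IsSES f g) : h.complex.ShortExact where
  exact := (ShortComplex.ShortExact.moduleCat_exact_iff_function_exact _).2 h.exact
  mono_f := (ModuleCat.mono_iff_injective _).2 h.inj
  epi_g := (ModuleCat.epi_iff_surjective _).2 h.surj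

theorem exists_extend (h : IsSES f g) (h3 : ExtVanish A X₃ Y 1) (φ : X₁ →ₗ[A] Y) :
    ∃ ψ : X₂ →ₗ[A] Y, ψ ∘ₗ f = φ := by
  obtain ⟨x, hx⟩ := Ext.contravariant_sequence_exact₁ h.shortExact (ModuleCat.of A Y)
    (Ext.mk₀ (ModuleCat.ofHom φ)) (add_zero 1) (h3.eq_zero _)
  obtain ⟨y, rfl⟩ := Ext.homEquiv₀.symm.surjective x
  refine ⟨y.hom, ?_⟩
  simp only [Ext.homEquiv₀_symm_apply, Ext.mk₀_comp_mk₀] at hx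
  have := (Ext.mk₀_bijective _ _).1 hx
  exact congrArg ModuleCat.Hom.hom this

theorem exists_lift {f : Y₁ →ₗ[A] Y₂} {g : Y₂ →ₗ[A] Y₃} (h : IsSES f g)
    (h1 : ExtVanish A X Y₁ 1) (φ : X →ₗ[A] Y₃) : ∃ ψ : X →ₗ[A] Y₂, g ∘ₗ ψ = φ := by
  obtain ⟨x, hx⟩ := Ext.covariant_sequence_exact₃ (ModuleCat.of A X) h.shortExact
    (Ext.mk₀ (ModuleCat.ofHom φ)) (zero_add 1) (h1.eq_zero _)
  obtain ⟨y, rfl⟩ := Ext.homEquiv₀.symm.surjective x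
  refine ⟨y.hom, ?_⟩
  simp only [Ext.homEquiv₀_symm_apply, Ext.mk₀_comp_mk₀] at hx
  have := (Ext.mk₀_bijective _ _).1 hx
  exact congrArg ModuleCat.Hom.hom this

theorem extVanish_left (h : IsSES f g) {i : ℕ} (h2 : ExtVanish A X₂ Y i)
    (h3 : ExtVanish A X₃ Y (i + 1)) : ExtVanish A X₁ Y i := by
  refine .of_eq_zero fun x => ?_
  obtain ⟨y, hy⟩ := Ext.contravariant_sequence_exact₁ h.shortExact (ModuleCat.of A Y) x (add_comm 1 i) (h3.eq_zero _)
  rw [← hy, h2.eq_zero y, Ext.comp_zero]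

theorem extVanish_mid (h : IsSES f g) {i : ℕ} (h1 : ExtVanish A X₁ Y i)
    (h3 : ExtVanish A X₃ Y i) : ExtVanish A X₂ Y i := by
  refine .of_eq_zero fun x => ?_
  obtain ⟨y, hy⟩ := Ext.contravariant_sequence_exact₂ h.shortExact (ModuleCat.of A Y) x (h1.eq_zero _)
  rw [← hy, h3.eq_zero y, Ext.comp_zero]

theorem extVanish_right (h : IsSES f g) {i : ℕ} (h1 : ExtVanish A X₁ Y i)
    (h2 : ExtVanish A X₂ Y (i + 1)) : ExtVanish A X₃ Y (i + 1) := by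
  refine .of_eq_zero fun x => ?_
  obtain ⟨y, hy⟩ := Ext.contravariant_sequence_exact₃ h.shortExact (ModuleCat.of A Y) x (h2.eq_zero _) (add_comm 1 i)
  rw [← hy, h1.eq_zero y, Ext.comp_zero]

/-- In degree one the preceding term of the long exact sequence is `Hom(X₁, Y)`, which need not
vanish; it is enough that restriction from `X₂` hits all of it. -/
theorem extVanish_right_one (h : IsSES f g) (h2 : ExtVanish A X₂ Y 1)
    (hφ : ∀ φ : X₁ →ₗ[A] Y, ∃ ψ : X₂ →ₗ[A] Y, ψ ∘ₗ f = φ) : ExtVanish A X₃ Y 1 := by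
  refine .of_eq_zero fun x => ?_
  obtain ⟨y, hy⟩ := Ext.contravariant_sequence_exact₃ h.shortExact (ModuleCat.of A Y) x (h2.eq_zero _) (add_zero 1)
  obtain ⟨φ, rfl⟩ := Ext.homEquiv₀.symm.surjective y
  obtain ⟨ψ, hψ⟩ := hφ φ.hom
  have e : φ = ModuleCat.ofHom f ≫ ModuleCat.ofHom ψ := by
    rw [← ModuleCat.ofHom_comp, hψ]; rfl
  rw [← hy, Ext.homEquiv₀_symm_apply, e, ← Ext.mk₀_comp_mk₀]
  exact h.shortExact.extClass_comp_assoc _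

theorem extVanish_coeff_left_one {f : Y₁ →ₗ[A] Y₂} {g : Y₂ →ₗ[A] Y₃} (h : IsSES f g)
    (h2 : ExtVanish A X Y₂ 1) (hφ : ∀ φ : X →ₗ[A] Y₃, ∃ ψ : X →ₗ[A] Y₂, g ∘ₗ ψ = φ) :
    ExtVanish A X Y₁ 1 := by
  refine .of_eq_zero fun x => ?_
  obtain ⟨y, hy⟩ := Ext.covariant_sequence_exact₁ (ModuleCat.of A X) h.shortExact x
    (h2.eq_zero _) (zero_add 1)
  obtain ⟨φ, rfl⟩ := Ext.homEquiv₀.symm.surjective y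
  obtain ⟨ψ, hψ⟩ := hφ φ.hom
  have e : φ = ModuleCat.ofHom ψ ≫ ModuleCat.ofHom g := by
    rw [← ModuleCat.ofHom_comp, hψ]; rfl
  rw [← hy, Ext.homEquiv₀_symm_apply, e, ← Ext.mk₀_comp_mk₀,
    Ext.comp_assoc_of_second_deg_zero, h.shortExact.comp_extClass, Ext.comp_zero]

theorem extVanish_coeff_right {f : Y₁ →ₗ[A] Y₂} {g : Y₂ →ₗ[A] Y₃} (h : IsSES f g) {i : ℕ}
    (h2 : ExtVanish A X Y₂ i) (h1 : ExtVanish A X Y₁ (i + 1)) : ExtVanish A X Y₃ i := by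
  refine .of_eq_zero fun x => ?_
  obtain ⟨y, hy⟩ := Ext.covariant_sequence_exact₃ (ModuleCat.of A X) h.shortExact x rfl
    (h1.eq_zero _)
  rw [← hy, h2.eq_zero y, Ext.zero_comp]

/-- `Ext¹(X₃, Y)` is the cokernel of `Hom(X₂, Y) → Hom(X₁, Y)` if `Ext¹(X₂, Y) = 0`. -/
theorem exists_connecting (h : IsSES f g) (h2 : ExtVanish A X₂ Y 1) :
    ∃ d : (X₁ →ₗ[A] Y) →+ Ext (ModuleCat.of A X₃) (ModuleCat.of A Y) 1,
      Function.Surjective d ∧ (∀ φ, d φ = 0 ↔ ∃ ψ : X₂ →ₗ[A] Y, ψ ∘ₗ f = φ) ∧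
      ∀ (r : Y →ₗ[A] Y) (φ : X₁ →ₗ[A] Y),
        d (r ∘ₗ φ) = (d φ).comp (Ext.mk₀ (ModuleCat.ofHom r)) (add_zero 1) := by
  refine ⟨{ toFun := fun φ => h.shortExact.extClass.comp (Ext.mk₀ (ModuleCat.ofHom φ)) (add_zero 1)
            map_zero' := ?_
            map_add' := ?_ }, ?_, ?_, ?_⟩
  · rw [ModuleCat.ofHom_zero, Ext.mk₀_zero, Ext.comp_zero]
  · intro φ ψ
    rw [ModuleCat.ofHom_add, Ext.mk₀_add, Ext.comp_add]
  · intro x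
    obtain ⟨y, hy⟩ := Ext.contravariant_sequence_exact₃ h.shortExact (ModuleCat.of A Y) x (h2.eq_zero _) (add_zero 1)
    obtain ⟨φ, rfl⟩ := Ext.homEquiv₀.symm.surjective y
    exact ⟨φ.hom, hy⟩
  · intro φ
    constructor
    · intro hx
      obtain ⟨x, hx⟩ := Ext.contravariant_sequence_exact₁ h.shortExact (ModuleCat.of A Y)
        (Ext.mk₀ (ModuleCat.ofHom φ)) (add_zero 1) hx
      obtain ⟨y, rfl⟩ := Ext.homEquiv₀.symm.surjective x
      refine ⟨y.hom, ?_⟩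
      simp only [Ext.homEquiv₀_symm_apply, Ext.mk₀_comp_mk₀] at hx
      exact congrArg ModuleCat.Hom.hom ((Ext.mk₀_bijective _ _).1 hx)
    · rintro ⟨ψ, rfl⟩
      change h.shortExact.extClass.comp (Ext.mk₀ (ModuleCat.ofHom (ψ ∘ₗ f))) (add_zero 1) = 0
      rw [ModuleCat.ofHom_comp, ← Ext.mk₀_comp_mk₀]
      exact h.shortExact.extClass_comp_assoc _
  · intro r φ
    change h.shortExact.extClass.comp (Ext.mk₀ (ModuleCat.ofHom (r ∘ₗ φ))) (add_zero 1) =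
      (h.shortExact.extClass.comp (Ext.mk₀ (ModuleCat.ofHom φ)) (add_zero 1)).comp _ _
    rw [ModuleCat.ofHom_comp, ← Ext.mk₀_comp_mk₀, Ext.comp_assoc_of_third_deg_zero]

/-- Dimension shifting `Ext¹(X₁, Y) ≃ Ext²(X₃, Y)`, compatible with endomorphisms of `Y`. -/
theorem exists_shift (h : IsSES f g) (h2 : ExtVanish A X₂ Y 1) (h2' : ExtVanish A X₂ Y 2) :
    ∃ d : Ext (ModuleCat.of A X₁) (ModuleCat.of A Y) 1 ≃+
        Ext (ModuleCat.of A X₃) (ModuleCat.of A Y) 2,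
      ∀ (r : Y →ₗ[A] Y) x, d (x.comp (Ext.mk₀ (ModuleCat.ofHom r)) (add_zero 1)) =
        (d x).comp (Ext.mk₀ (ModuleCat.ofHom r)) (add_zero 2) := by
  refine ⟨AddEquiv.ofBijective (h.shortExact.extClass.precomp (ModuleCat.of A Y) (add_comm 1 1))
    ⟨?_, ?_⟩, ?_⟩
  · rw [injective_iff_map_eq_zero]
    intro x hx
    obtain ⟨y, hy⟩ := Ext.contravariant_sequence_exact₁ h.shortExact (ModuleCat.of A Y) x (add_comm 1 1) hx
    rw [← hy, h2.eq_zero y, Ext.comp_zero]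
  · intro x
    exact Ext.contravariant_sequence_exact₃ h.shortExact (ModuleCat.of A Y) x (h2'.eq_zero _) (add_comm 1 1)
  · intro r x
    exact (Ext.comp_assoc_of_third_deg_zero h.shortExact.extClass x
      (Ext.mk₀ (ModuleCat.ofHom r)) (add_comm 1 1)).symm

end IsSES

theorem isSES_subtype_mkQ (N : Submodule A X) : IsSES N.subtype N.mkQ :=
  ⟨N.subtype_injective, LinearMap.exact_subtype_mkQ N, N.mkQ_surjective⟩

theorem isSES_mkQ_range {f : X₁ →ₗ[A] X₂} (hf : Function.Injective f) :
    IsSES f (LinearMap.range f).mkQ :=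
  ⟨hf, LinearMap.exact_map_mkQ_range f, Submodule.mkQ_surjective _⟩

theorem isSES_ker_subtype {g : X₂ →ₗ[A] X₃} (hg : Function.Surjective g) :
    IsSES (LinearMap.ker g).subtype g :=
  ⟨Submodule.subtype_injective _, LinearMap.exact_subtype_ker_map g, hg⟩

theorem isSES_rangeRestrict (g : X₂ →ₗ[A] X₃) :
    IsSES (LinearMap.ker g).subtype g.rangeRestrict := by
  refine ⟨Submodule.subtype_injective _, ?_, g.surjective_rangeRestrict⟩
  rw [LinearMap.exact_iff, LinearMap.ker_rangeRestrict, Submodule.range_subtype]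

theorem extVanish_of_projective [Module.Projective A X] (i : ℕ) (hi : 1 ≤ i) :
    ExtVanish A X Y i := by
  have : Projective (ModuleCat.of A X) := (IsProjective.iff_projective X).1 inferInstance
  obtain ⟨j, rfl⟩ := Nat.exists_eq_add_of_le' hi
  exact .of_eq_zero fun x => Ext.eq_zero_of_projective x

theorem extVanish_of_injective [Module.Injective A Y] (i : ℕ) (hi : 1 ≤ i) :
    ExtVanish A X Y i := by
  have : Injective (ModuleCat.of A Y) := (Module.injective_iff_injective_object A Y).1 inferInstance
  obtain ⟨j, rfl⟩ := Nat.exists_eq_add_of_le' hi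
  exact .of_eq_zero fun x => Ext.eq_zero_of_injective x

theorem extVanish_of_subsingleton [Subsingleton X] (i : ℕ) : ExtVanish A X Y i := by
  refine .of_eq_zero fun x => ?_
  have : (𝟙 (ModuleCat.of A X)) = 0 := by
    ext y
    exact Subsingleton.elim (α := X) _ _
  rw [← Ext.mk₀_id_comp x, this, Ext.mk₀_zero, Ext.zero_comp]

theorem isSES_single_succ (k : ℕ) :
    IsSES (LinearMap.single A (fun _ : Fin (k + 1) => X) 0)
      (LinearMap.funLeft A X (Fin.succ : Fin k → Fin (k + 1))) := by
  refine ⟨fun x y h => by simpa using congrFun h 0, ?_, ?_⟩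
  · intro x
    constructor
    · intro hx
      refine ⟨x 0, ?_⟩
      ext i
      refine Fin.cases ?_ (fun j => ?_) i
      · simp
      · have := congrFun hx j
        simp only [LinearMap.funLeft_apply] at this
        simp [this]
    · rintro ⟨y, rfl⟩
      ext j
      simp [LinearMap.funLeft_apply]
  · intro x
    refine ⟨Fin.cons 0 x, ?_⟩
    ext j
    simp [LinearMap.funLeft_apply]

theorem ExtVanish.pi {i : ℕ} (h : ExtVanish A X Y i) (k : ℕ) : ExtVanish A (Fin k → X) Y i := by
  induction k with
  | zero => exact extVanish_of_subsingleton i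
  | succ k ih => exact (isSES_single_succ k).extVanish_mid h ih

end ExtTools

/-! ### Duality with respect to `U` and biduals of finitely generated modules -/

section Duality

variable {A B : Type u} [Ring A] [Ring B] {U : Type u} [AddCommGroup U] [Module A U] [Module B U]
  [SMulCommClass A B U]
variable {X Y Z M : Type u} [AddCommGroup X] [AddCommGroup Y] [AddCommGroup Z] [AddCommGroup M]
  [Module A X] [Module A Y] [Module A Z]

theorem ExtVanish.of_equiv {i : ℕ} (e : X ≃ₗ[A] Y) (h : ExtVanish A X Z i) :
    ExtVanish A Y Z i := by
  refine .of_eq_zero fun x => ?_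
  have h1 : ModuleCat.ofHom e.symm.toLinearMap ≫ ModuleCat.ofHom e.toLinearMap = 𝟙 _ := by
    ext y
    exact e.apply_symm_apply y
  rw [← Ext.mk₀_id_comp x, ← h1, ← Ext.mk₀_comp_mk₀_assoc, h.eq_zero ((Ext.mk₀ _).comp x _), Ext.comp_zero]

/-- If `0 → Z → M₀ → M₁` is exact, the vanishing of `Ext` of `Z` follows from that of `M₀`, `M₁`
and from a bound on the injective dimension of the second argument. -/
theorem extVanish_of_copresentation {M₀ M₁ : Type u} [AddCommGroup M₀] [AddCommGroup M₁]
    [Module A M₀] [Module A M₁] {f : X →ₗ[A] M₀} {g : M₀ →ₗ[A] M₁} (hf : Function.Injective f)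
    (hfg : Function.Exact f g) {i : ℕ} (h0 : ExtVanish A M₀ Y i) (h1 : ExtVanish A M₁ Y (i + 1))
    (h2 : ∀ (W : Type u) [AddCommGroup W] [Module A W], ExtVanish A W Y (i + 2)) :
    ExtVanish A X Y i := by
  have h : IsSES f g.rangeRestrict := by
    refine ⟨hf, ?_, g.surjective_rangeRestrict⟩
    rw [LinearMap.exact_iff, LinearMap.ker_rangeRestrict, hfg.linearMap_ker_eq]
  exact h.extVanish_left h0 ((isSES_subtype_mkQ (LinearMap.range g)).extVanish_left h1 (h2 _))

/-- The `B`-linear map `Hom_A(Y, U) → Hom_A(X, U)` induced by `f : X → Y`. -/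
def dualMap (B : Type u) [Ring B] (U : Type u) [AddCommGroup U] [Module A U] [Module B U]
    [SMulCommClass A B U] (f : X →ₗ[A] Y) : (Y →ₗ[A] U) →ₗ[B] (X →ₗ[A] U) where
  toFun g := g ∘ₗ f
  map_add' _ _ := rfl
  map_smul' _ _ := rfl

@[simp]
theorem dualMap_apply (f : X →ₗ[A] Y) (g : Y →ₗ[A] U) : dualMap B U f g = g ∘ₗ f := rfl

theorem dualMap_injective {f : X →ₗ[A] Y} (hf : Function.Surjective f) :
    Function.Injective (dualMap B U f) := fun _ _ h =>
  LinearMap.ext fun y => by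
    obtain ⟨x, rfl⟩ := hf y
    exact LinearMap.congr_fun h x

theorem exists_factor_of_ker_le {f : X →ₗ[A] Y} (hf : Function.Surjective f) (g : X →ₗ[A] Z)
    (hg : ∀ x, f x = 0 → g x = 0) : ∃ h : Y →ₗ[A] Z, h ∘ₗ f = g := by
  refine ⟨(LinearMap.ker f).liftQ g (fun x hx => hg x hx) ∘ₗ
    (f.quotKerEquivOfSurjective hf).symm.toLinearMap, ?_⟩
  ext x
  have : (f.quotKerEquivOfSurjective hf).symm (f x) = Submodule.Quotient.mk x := by
    rw [LinearEquiv.symm_apply_eq]; rfl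
  simpa [this] using Submodule.liftQ_apply _ g x

theorem dualMap_exact {f : X →ₗ[A] Y} {g : Y →ₗ[A] Z} (hfg : Function.Exact f g)
    (hg : Function.Surjective g) : Function.Exact (dualMap B U g) (dualMap B U f) := by
  intro φ
  constructor
  · intro h
    obtain ⟨ψ, hψ⟩ := exists_factor_of_ker_le hg φ fun y hy => by
      obtain ⟨x, rfl⟩ := (hfg y).1 hy
      exact LinearMap.congr_fun h x
    exact ⟨ψ, hψ⟩
  · rintro ⟨ψ, rfl⟩
    ext x
    simp [hfg.apply_apply_eq_zero]

/-- Evaluation at `x`, as a `B`-linear map `Hom_A(X, U) → U`. -/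
def evalMap (B : Type u) [Ring B] (U : Type u) [AddCommGroup U] [Module A U] [Module B U]
    [SMulCommClass A B U] (x : X) : (X →ₗ[A] U) →ₗ[B] U where
  toFun g := g x
  map_add' _ _ := rfl
  map_smul' _ _ := rfl

@[simp]
theorem evalMap_apply (x : X) (g : X →ₗ[A] U) : evalMap B U x g = g x := rfl

/-- The dual of a free module of finite rank. -/
def freeDual (A B U : Type u) [Ring A] [Ring B] [AddCommGroup U] [Module A U] [Module B U]
    [SMulCommClass A B U] (k : ℕ) : (Fin k → U) ≃ₗ[B] ((Fin k → A) →ₗ[A] U) :=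
  (Pi.basisFun A (Fin k)).constr B

theorem freeDual_apply (k : ℕ) (u : Fin k → U) (a : Fin k → A) :
    freeDual A B U k u a = ∑ i, a i • u i := by
  simp [freeDual, Module.Basis.constr_apply_fintype]

variable (A B U) in
/-- `A` acts on `U` as the full endomorphism ring of `U` over `B`, `U` is selforthogonal over `B`
and the injective dimension of `U` over `B` is at most two. -/
structure IsDualizing : Prop where
  exists_smul : ∀ φ : U →ₗ[B] U, ∃ a : A, ∀ x, φ x = a • x
  eq_zero_of_smul : ∀ a : A, (∀ x : U, a • x = 0) → a = 0
  extVanish_self : ∀ i, 1 ≤ i → ExtVanish B U U i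
  extVanish : ∀ i, 3 ≤ i → ∀ (W : Type u) [AddCommGroup W] [Module B W], ExtVanish B W U i

namespace IsDualizing

variable (h : IsDualizing A B U)
include h

theorem extVanish_freeDual (k i : ℕ) (hi : 1 ≤ i) :
    ExtVanish B ((Fin k → A) →ₗ[A] U) U i :=
  ((h.extVanish_self i hi).pi k).of_equiv (freeDual A B U k)

theorem exists_eval_free {k : ℕ} (γ : ((Fin k → A) →ₗ[A] U) →ₗ[B] U) :
    ∃ a, γ = evalMap B U a := by
  choose a ha using fun i => h.exists_smul
    (γ ∘ₗ (freeDual A B U k).toLinearMap ∘ₗ LinearMap.single B (fun _ => U) i)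
  refine ⟨a, LinearMap.ext fun g => ?_⟩
  obtain ⟨u, rfl⟩ := (freeDual A B U k).surjective g
  rw [evalMap_apply, freeDual_apply]
  have hu : u = ∑ i, LinearMap.single B (fun _ => U) i (u i) := by
    ext j; simp [Finset.sum_apply, Pi.single_apply]
  conv_lhs => rw [hu]
  simp only [map_sum]
  exact Finset.sum_congr rfl fun i _ => ha i (u i)

omit [SMulCommClass A B U] in
theorem eq_of_forall_free {k : ℕ} {x y : Fin k → A}
    (hxy : ∀ g : (Fin k → A) →ₗ[A] U, g x = g y) : x = y := by
  ext i
  rw [← sub_eq_zero]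
  refine h.eq_zero_of_smul _ fun u => ?_
  have := hxy (LinearMap.toSpanSingleton A U u ∘ₗ LinearMap.proj i)
  simpa [sub_smul, sub_eq_zero] using this

/-- A finite presentation of `X` dualizes to an exact sequence `0 → X* → U^m → U^n`. Its two
right-hand terms have no higher `Ext` into `U`, and the cokernel contributes only in degree `i + 2 ≥
3`. -/
theorem extVanish_dual [IsNoetherianRing A] [Module.Finite A X] (i : ℕ) (hi : 1 ≤ i) :
    ExtVanish B (X →ₗ[A] U) U i := by
  obtain ⟨m, p, hp⟩ := Module.Finite.exists_fin' A X
  obtain ⟨n, q, hq⟩ := Module.Finite.exists_fin' A (LinearMap.ker p)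
  have hpq : Function.Exact ((LinearMap.ker p).subtype ∘ₗ q) p := by
    rw [LinearMap.exact_iff, LinearMap.range_comp, LinearMap.range_eq_top.2 hq]
    simp
  exact extVanish_of_copresentation (dualMap_injective hp) (dualMap_exact hpq hp)
    (h.extVanish_freeDual m i hi) (h.extVanish_freeDual n _ (by lia)) (h.extVanish _ (by lia))

/-- Every finitely generated `X` with `Ext¹(X, U) = 0` maps onto its bidual. -/
theorem exists_eval [IsNoetherianRing A] [Module.Finite A X] (hX : ExtVanish A X U 1)
    (γ : (X →ₗ[A] U) →ₗ[B] U) : ∃ x, γ = evalMap B U x := by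
  obtain ⟨m, p, hp⟩ := Module.Finite.exists_fin' A X
  obtain ⟨n, q, hq⟩ := Module.Finite.exists_fin' A (LinearMap.ker p)
  obtain ⟨k, r, hr⟩ := Module.Finite.exists_fin' A (LinearMap.ker q)
  have hpq : Function.Exact ((LinearMap.ker p).subtype ∘ₗ q) p := by
    rw [LinearMap.exact_iff, LinearMap.range_comp, LinearMap.range_eq_top.2 hq]
    simp
  have hqr : Function.Exact ((LinearMap.ker q).subtype ∘ₗ r) q := by
    rw [LinearMap.exact_iff, LinearMap.range_comp, LinearMap.range_eq_top.2 hr]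
    simp
  set d := dualMap B U ((LinearMap.ker p).subtype ∘ₗ q) with hd
  -- As `Ext¹(X, U) = 0`, maps from the first syzygy to `U` extend to the free module, so the image
  -- of `d` is the whole kernel of the next dual map. It therefore has no `Ext¹` into `U`, and
  -- functionals on `X*` extend to the dual of a free module, where they are evaluations.
  have hex : Function.Exact (LinearMap.range d).subtype
      (dualMap B U ((LinearMap.ker q).subtype ∘ₗ r)) := by
    intro φ
    rw [dualMap_exact (B := B) (U := U) hqr hq φ]
    constructor
    · rintro ⟨ψ, rfl⟩
      obtain ⟨χ, rfl⟩ := (isSES_ker_subtype hp).exists_extend hX ψ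
      exact ⟨⟨d χ, χ, rfl⟩, rfl⟩
    · rintro ⟨⟨_, χ, rfl⟩, rfl⟩
      exact ⟨χ ∘ₗ (LinearMap.ker p).subtype, rfl⟩
  have hv : ExtVanish B (LinearMap.range d) U 1 :=
    extVanish_of_copresentation (Submodule.subtype_injective _) hex
      (h.extVanish_freeDual n 1 le_rfl) (h.extVanish_freeDual k 2 (by lia))
      (h.extVanish 3 le_rfl)
  have hs : IsSES (dualMap B U p) d.rangeRestrict := by
    refine ⟨dualMap_injective hp, ?_, d.surjective_rangeRestrict⟩
    rw [LinearMap.exact_iff, LinearMap.ker_rangeRestrict,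
      (dualMap_exact (B := B) (U := U) hpq hp).linearMap_ker_eq]
  obtain ⟨γ', rfl⟩ := hs.exists_extend hv γ
  obtain ⟨a, rfl⟩ := h.exists_eval_free γ'
  exact ⟨p a, rfl⟩

end IsDualizing

variable (B U) in
/-- The action of `a` on `U` as a `B`-linear map. -/
def actMap (a : A) : U →ₗ[B] U where
  toFun x := a • x
  map_add' := smul_add a
  map_smul' b x := smul_comm a b x

variable [Module A M]

variable (A B U) in
/-- The class of finitely generated `A`-modules of the form `Ext_Bⁿ(N, U)` with `N` a finitely
generated `B`-module. -/
def IsExtModule (n : ℕ) (M : Type u) [AddCommGroup M] [Module A M] : Prop :=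
  Module.Finite A M ∧ ∃ N : ModuleCat.{u} B, Module.Finite B N ∧
    ∃ e : M ≃+ Ext N (ModuleCat.of B U) n,
      ∀ (r : A) (m : M), e (r • m) =
        (e m).comp (Ext.mk₀ (ModuleCat.ofHom (actMap B U r))) (add_zero n)

theorem exists_addEquiv_of_ker_eq {G H K : Type*} [AddCommGroup G] [AddCommGroup H]
    [AddCommGroup K] (p : G →+ H) (q : G →+ K) (hp : Function.Surjective p)
    (hq : Function.Surjective q) (hpq : ∀ x, p x = 0 ↔ q x = 0) :
    ∃ e : H ≃+ K, ∀ x, e (p x) = q x := by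
  have hk : p.ker = q.ker := by ext x; exact hpq x
  refine ⟨(QuotientAddGroup.quotientKerEquivOfSurjective p hp).symm.trans
    ((QuotientAddGroup.quotientAddEquivOfEq hk).trans
      (QuotientAddGroup.quotientKerEquivOfSurjective q hq)), fun x => ?_⟩
  have : (QuotientAddGroup.quotientKerEquivOfSurjective p hp).symm (p x) = (x : G ⧸ p.ker) := by
    rw [AddEquiv.symm_apply_eq]; rfl
  simp only [AddEquiv.trans_apply, this]
  rfl

/-- A module isomorphic to `Ext_B¹(X₃, U)` is the cokernel of `Hom_B(X₂, U) → Hom_B(X₁, U)`. -/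
theorem exists_linear_connecting {X₁ X₂ X₃ : Type u} [AddCommGroup X₁] [AddCommGroup X₂]
    [AddCommGroup X₃] [Module B X₁] [Module B X₂] [Module B X₃] {f : X₁ →ₗ[B] X₂}
    {g : X₂ →ₗ[B] X₃} (hfg : IsSES f g) (h2 : ExtVanish B X₂ U 1) [SMulCommClass B A U]
    (e : M ≃+ Ext (ModuleCat.of B X₃) (ModuleCat.of B U) 1)
    (he : ∀ (r : A) (m : M), e (r • m) =
        (e m).comp (Ext.mk₀ (ModuleCat.ofHom (actMap B U r))) (add_zero 1)) :
    ∃ π : (X₁ →ₗ[B] U) →ₗ[A] M, Function.Surjective π ∧ Function.Exact (dualMap A U f) π := by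
  obtain ⟨d, hd, hd0, hr⟩ := hfg.exists_connecting h2
  refine ⟨{ toFun := fun φ => e.symm (d φ)
            map_add' := fun φ ψ => by simp
            map_smul' := fun r φ => ?_ }, e.symm.surjective.comp hd, fun φ => ?_⟩
  · rw [RingHom.id_apply, AddEquiv.symm_apply_eq, he, AddEquiv.apply_symm_apply]
    exact hr (actMap B U r) φ
  · exact (e.symm.map_eq_zero_iff).trans (hd0 φ)

end Duality

/-! ### Intrinsic description of the modules `Ext¹(N, U)` and `Ext²(N, U)` -/

section ExtModules

variable {A B : Type u} [Ring A] [Ring B] {U : Type u} [AddCommGroup U] [Module A U] [Module B U]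
  [SMulCommClass A B U]
variable {M : Type u} [AddCommGroup M] [Module A M]

theorem IsDualizing.eq_of_evalMap_eq (hA : IsDualizing A B U) {k : ℕ} {x y : Fin k → A}
    (hxy : evalMap (A := A) B U x = evalMap B U y) : x = y :=
  hA.eq_of_forall_free fun g => LinearMap.congr_fun hxy g

omit [SMulCommClass A B U] in
/-- A cokernel of `Hom_B(Q, U) → Hom_B(L, U)`, where `L` is a submodule of the free module `Q` with
`Ext_B¹(L, U) = 0`, has no nonzero map to `U`. -/
theorem eq_zero_of_cokernel [IsNoetherianRing B] [SMulCommClass B A U] (hB : IsDualizing B A U)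
    {L : Type u} [AddCommGroup L] [Module B L]
    [Module.Finite B L] (hL : ExtVanish B L U 1) {k : ℕ} {f : L →ₗ[B] (Fin k → B)}
    (hf : Function.Injective f) {π : (L →ₗ[B] U) →ₗ[A] M} (hπ : Function.Surjective π)
    (hfπ : Function.Exact (dualMap A U f) π) (g : M →ₗ[A] U) : g = 0 := by
  -- The composite is evaluation at some `l`. It kills all maps that extend to the free module, so
  -- no map from the free module to `U` detects `f l`.
  obtain ⟨l, hl⟩ := hB.exists_eval hL (g ∘ₗ π)
  have hfl : f l = 0 := hB.eq_of_forall_free fun ψ => by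
    have h1 : π (ψ ∘ₗ f) = 0 := hfπ.apply_apply_eq_zero ψ
    have h2 := LinearMap.congr_fun hl (ψ ∘ₗ f)
    simpa [h1] using h2.symm
  have hl0 : l = 0 := hf (hfl.trans (map_zero f).symm)
  ext m
  obtain ⟨φ, rfl⟩ := hπ m
  simpa [hl0] using LinearMap.congr_fun hl φ

theorem IsExtModule.one_hom_eq_zero [IsNoetherianRing B] [SMulCommClass B A U]
    (hB : IsDualizing B A U)
    (hid : ∀ (W : Type u) [AddCommGroup W] [Module B W], ExtVanish B W U 2)
    (hM : IsExtModule A B U 1 M) (g : M →ₗ[A] U) : g = 0 := by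
  obtain ⟨-, N, hN, e, he⟩ := hM
  obtain ⟨k, p, hp⟩ := Module.Finite.exists_fin' B N
  obtain ⟨π, hπ, hfπ⟩ := exists_linear_connecting (isSES_ker_subtype hp)
    (extVanish_of_projective 1 le_rfl) e he
  exact eq_zero_of_cokernel hB
    ((isSES_ker_subtype hp).extVanish_left (extVanish_of_projective 1 le_rfl) (hid N))
    (Submodule.subtype_injective _) hπ hfπ g

/-- With a free presentation `F₁ → F₀ → N` and second syzygy `L`, dimension shifting gives `M` as
the cokernel of `F₁* → L*`, and `Ext¹(L, U) = Ext³(N, U) = 0`. -/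
theorem IsExtModule.two_hom_eq_zero [IsNoetherianRing B] [SMulCommClass B A U]
    (hA : IsDualizing A B U) (hB : IsDualizing B A U)
    (hM : IsExtModule A B U 2 M) :
    (∀ g : M →ₗ[A] U, g = 0) ∧ ExtVanish A M U 1 := by
  obtain ⟨-, N, hN, e, he⟩ := hM
  obtain ⟨k₀, p₀, hp₀⟩ := Module.Finite.exists_fin' B N
  obtain ⟨k, p, hp⟩ := Module.Finite.exists_fin' B (LinearMap.ker p₀)
  obtain ⟨s, hs⟩ := (isSES_ker_subtype hp₀).exists_shift (Y := U)
    (extVanish_of_projective 1 le_rfl) (extVanish_of_projective 2 (by lia))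
  have hes : ∀ (r : A) (m : M), (e.trans s.symm) (r • m) =
        ((e.trans s.symm) m).comp (Ext.mk₀ (ModuleCat.ofHom (actMap B U r))) (add_zero 1) := by
    intro r m
    simp only [AddEquiv.trans_apply]
    rw [AddEquiv.symm_apply_eq, hs, AddEquiv.apply_symm_apply]
    exact he r m
  obtain ⟨π, hπ, hfπ⟩ := exists_linear_connecting (isSES_ker_subtype hp)
    (extVanish_of_projective 1 le_rfl) (e.trans s.symm) hes
  have hL : ExtVanish B (LinearMap.ker p) U 1 :=
    (isSES_ker_subtype hp).extVanish_left (extVanish_of_projective 1 le_rfl)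
      ((isSES_ker_subtype hp₀).extVanish_left (extVanish_of_projective 2 (by lia))
        (hA.extVanish 3 le_rfl N))
  refine ⟨fun g => eq_zero_of_cokernel hB hL (Submodule.subtype_injective _) hπ hfπ g, ?_⟩
  refine (isSES_ker_subtype hπ).extVanish_right_one (hB.extVanish_dual 1 le_rfl) fun φ => ?_
  -- A functional on `ker π`, the image of `F₁*`, pulls back to evaluation at some `q` in `F₁`. It
  -- vanishes on maps coming from `F₀`, so `q` lies in `L`, and evaluation at `q` on `L*` is the
  -- required extension.
  obtain ⟨q, hq⟩ := hB.exists_eval_free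
    (φ ∘ₗ (dualMap A U (LinearMap.ker p).subtype).codRestrict (LinearMap.ker π)
      fun ψ => hfπ.apply_apply_eq_zero ψ)
  have hpq : (p q : Fin k₀ → B) = 0 := hB.eq_of_forall_free fun ψ => by
    have h1 := LinearMap.congr_fun hq (ψ ∘ₗ (LinearMap.ker p₀).subtype ∘ₗ p)
    have h2 : (dualMap A U (LinearMap.ker p).subtype).codRestrict (LinearMap.ker π)
        (fun ψ => hfπ.apply_apply_eq_zero ψ) (ψ ∘ₗ (LinearMap.ker p₀).subtype ∘ₗ p) = 0 := by
      ext l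
      change ψ (p l : Fin k₀ → B) = 0
      rw [show p l = 0 from l.2]
      simp
    rw [LinearMap.comp_apply, h2] at h1
    simpa using h1.symm
  refine ⟨evalMap A U (⟨q, Subtype.ext hpq⟩ : LinearMap.ker p), ?_⟩
  ext ⟨χ, hχ⟩
  obtain ⟨ψ, rfl⟩ := (hfπ χ).1 hχ
  exact (LinearMap.congr_fun hq ψ).symm

/-- Criterion for an `A`-module presented as a quotient of a free module to be isomorphic
to an `Ext` group. -/
theorem isExtModule_of_surjective {n k : ℕ} {p : (Fin k → A) →ₗ[A] M}
    (hp : Function.Surjective p) (N : Type u) [AddCommGroup N] [Module B N] [Module.Finite B N]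
    (hA : IsDualizing A B U)
    (d : (((Fin k → A) →ₗ[A] U) →ₗ[B] U) →+ Ext (ModuleCat.of B N) (ModuleCat.of B U) n)
    (hd : Function.Surjective d) (hd0 : ∀ a, d (evalMap B U a) = 0 ↔ p a = 0)
    (hr : ∀ (r : U →ₗ[B] U) φ,
      d (r ∘ₗ φ) = (d φ).comp (Ext.mk₀ (ModuleCat.ofHom r)) (add_zero n)) :
    IsExtModule A B U n M := by
  refine ⟨Module.Finite.of_surjective p hp, ModuleCat.of B N, inferInstanceAs (Module.Finite B N),
    ?_⟩
  let q : (Fin k → A) →+ Ext (ModuleCat.of B N) (ModuleCat.of B U) n :=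
    d.comp { toFun := fun a => evalMap B U a
             map_zero' := by ext; simp
             map_add' := fun _ _ => by ext; simp }
  have hq : Function.Surjective q := fun x => by
    obtain ⟨φ, rfl⟩ := hd x
    obtain ⟨a, rfl⟩ := hA.exists_eval_free φ
    exact ⟨a, rfl⟩
  obtain ⟨e, he⟩ := exists_addEquiv_of_ker_eq p.toAddMonoidHom q hp hq fun a => (hd0 a).symm
  refine ⟨e, fun r m => ?_⟩
  obtain ⟨a, rfl⟩ := hp m
  have h1 : e (p a) = d (evalMap B U a) := he a
  have h2 : e (p (r • a)) = d (evalMap B U (r • a)) := he (r • a)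
  rw [← map_smul, h1, h2, ← hr]
  congr 1
  ext g
  exact map_smul g r a

theorem finite_dual [IsNoetherianRing B] [Module.Finite B U] (X : Type u) [AddCommGroup X] [Module A X]
    [Module.Finite A X] : Module.Finite B (X →ₗ[A] U) := by
  obtain ⟨m, p, hp⟩ := Module.Finite.exists_fin' A X
  have : Module.Finite B ((Fin m → A) →ₗ[A] U) := Module.Finite.equiv (freeDual A B U m)
  exact Module.Finite.of_injective _ (dualMap_injective (B := B) (U := U) hp)

/-- Let `0 → K → F → M → 0` be exact with `F` free. Then `F* → K*` is injective, and its cokernel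
serves as `N`: `Ext¹(N, U)` is the cokernel of `K** → F**`. Since `F** = F` and `K → K**` is onto,
this is `F / K`. -/
theorem isExtModule_one [IsNoetherianRing A] [IsNoetherianRing B] [Module.Finite A M]
    [Module.Finite B U] (hA : IsDualizing A B U)
    (hid : ExtVanish A M U 2) (hM : ∀ g : M →ₗ[A] U, g = 0) :
    IsExtModule A B U 1 M := by
  obtain ⟨k, p, hp⟩ := Module.Finite.exists_fin' A M
  have hK : ExtVanish A (LinearMap.ker p) U 1 :=
    (isSES_ker_subtype hp).extVanish_left (extVanish_of_projective 1 le_rfl) hid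
  have := finite_dual (A := A) (B := B) (U := U) (LinearMap.ker p)
  have hinj : Function.Injective (dualMap B U (LinearMap.ker p).subtype) := by
    rw [injective_iff_map_eq_zero]
    intro g hg
    obtain ⟨g', rfl⟩ := exists_factor_of_ker_le hp g fun x hx => LinearMap.congr_fun hg ⟨x, hx⟩
    simp [hM g']
  obtain ⟨d, hd, hd0, hr⟩ := (isSES_mkQ_range hinj).exists_connecting (Y := U)
    (hA.extVanish_dual 1 le_rfl)
  refine isExtModule_of_surjective hp _ hA d hd (fun a => ?_) hr
  rw [hd0]
  constructor
  · rintro ⟨ψ, hψ⟩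
    obtain ⟨x, rfl⟩ := hA.exists_eval hK ψ
    have : (x : Fin k → A) = a := hA.eq_of_evalMap_eq hψ
    rw [← this]
    exact x.2
  · intro ha
    exact ⟨evalMap B U (⟨a, ha⟩ : LinearMap.ker p), rfl⟩

/-- For `0 → L → F₁ → F₀ → M → 0` with `F₀`, `F₁` free, the two vanishing conditions make `0 → F₀* →
F₁* → L*` exact. Taking for `N` the cokernel of the last map, `Ext²(N, U)` is `Ext¹` of the image of
`F₁*`, hence the cokernel of `F₁** → F₀**`, which is `M`. -/
theorem isExtModule_two [IsNoetherianRing A] [IsNoetherianRing B] [Module.Finite A M]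
    [Module.Finite B U] (hA : IsDualizing A B U)
    (hM1 : ExtVanish A M U 1) (hM : ∀ g : M →ₗ[A] U, g = 0) :
    IsExtModule A B U 2 M := by
  obtain ⟨k, p, hp⟩ := Module.Finite.exists_fin' A M
  obtain ⟨k₁, p₁, hp₁⟩ := Module.Finite.exists_fin' A (LinearMap.ker p)
  have := finite_dual (A := A) (B := B) (U := U) (LinearMap.ker p₁)
  set d := (LinearMap.ker p).subtype ∘ₗ p₁ with hd
  set j := dualMap B U (LinearMap.ker p₁).subtype with hj
  have hses : IsSES (dualMap B U d) j.rangeRestrict := by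
    refine ⟨?_, ?_, j.surjective_rangeRestrict⟩
    · rw [injective_iff_map_eq_zero]
      intro g hg
      obtain ⟨g', rfl⟩ := exists_factor_of_ker_le hp g fun x hx => by
        obtain ⟨y, hy⟩ := hp₁ ⟨x, hx⟩
        have h1 := LinearMap.congr_fun hg y
        simpa [hd, hy] using h1
      simp [hM g']
    · rw [LinearMap.exact_iff, LinearMap.ker_rangeRestrict]
      ext g
      constructor
      · intro hg
        obtain ⟨g', rfl⟩ := exists_factor_of_ker_le hp₁ g
          fun x hx => LinearMap.congr_fun hg ⟨x, hx⟩
        obtain ⟨g'', rfl⟩ := (isSES_ker_subtype hp).exists_extend hM1 g'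
        exact ⟨g'', rfl⟩
      · rintro ⟨g', rfl⟩
        ext x
        change g' (p₁ x : Fin k → A) = 0
        rw [show p₁ x = 0 from x.2]
        simp
  obtain ⟨c, hc, hc0, hr⟩ := hses.exists_connecting (Y := U) (hA.extVanish_freeDual k₁ 1 le_rfl)
  obtain ⟨s, hs⟩ := (isSES_subtype_mkQ (LinearMap.range j)).exists_shift (Y := U)
    (hA.extVanish_dual 1 le_rfl) (hA.extVanish_dual 2 (by lia))
  refine isExtModule_of_surjective hp _ hA (s.toAddMonoidHom.comp c) (s.surjective.comp hc)
    (fun a => ?_) fun r φ => ?_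
  · rw [AddMonoidHom.comp_apply]
    refine s.map_eq_zero_iff.trans ?_
    rw [hc0]
    constructor
    · rintro ⟨ψ, hψ⟩
      obtain ⟨x, rfl⟩ := hA.exists_eval_free ψ
      have : d x = a := hA.eq_of_evalMap_eq hψ
      rw [← this]
      exact (p₁ x).2
    · intro ha
      obtain ⟨y, hy⟩ := hp₁ ⟨a, ha⟩
      refine ⟨evalMap B U y, ?_⟩
      ext g
      simp [hd, hy]
  · change s (c (r ∘ₗ φ)) = _
    rw [hr, hs]
    rfl

end ExtModules

/-! ### Corestriction to kernels in exact sequences -/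

section KerLift

variable {A X Y Z W : Type*} [Ring A] [AddCommGroup X] [AddCommGroup Y] [AddCommGroup Z]
  [AddCommGroup W] [Module A X] [Module A Y] [Module A Z] [Module A W]

/-- The map `X → ker g` induced by `f`, for an exact sequence `X → Y → Z`. -/
def kerLift (f : X →ₗ[A] Y) (g : Y →ₗ[A] Z) (h : Function.Exact f g) : X →ₗ[A] LinearMap.ker g :=
  f.codRestrict (LinearMap.ker g) fun x => LinearMap.mem_ker.2 (h.apply_apply_eq_zero x)

theorem kerLift_surjective {f : X →ₗ[A] Y} {g : Y →ₗ[A] Z} (h : Function.Exact f g) :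
    Function.Surjective (kerLift f g h) := by
  rintro ⟨y, hy⟩
  obtain ⟨x, hx⟩ := (h y).1 hy
  exact ⟨x, Subtype.ext hx⟩

theorem exact_kerLift {e : W →ₗ[A] X} {f : X →ₗ[A] Y} {g : Y →ₗ[A] Z} (h : Function.Exact f g)
    (he : Function.Exact e f) : Function.Exact e (kerLift f g h) := fun x =>
  Subtype.ext_iff.trans (he x)

end KerLift

/-! ### Symmetry: transferring the tilting conditions from `R` to `S` -/

section Coresolution

variable {A B : Type u} [Ring A] [Ring B] {U : Type u} [AddCommGroup U] [Module A U] [Module B U]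
  [SMulCommClass A B U]
variable {V : Type u} [AddCommGroup V] [Module A V]

theorem InAdd.exists_retraction (hV : InAdd A U V) :
    ∃ (k : ℕ) (r : ((Fin k → U) →ₗ[A] U) →ₗ[B] (V →ₗ[A] U))
      (s : (V →ₗ[A] U) →ₗ[B] ((Fin k → U) →ₗ[A] U)), r ∘ₗ s = LinearMap.id := by
  obtain ⟨k, i, p, hip⟩ := hV
  refine ⟨k, dualMap B U i, dualMap B U p, ?_⟩
  ext g v
  exact congrArg g (LinearMap.congr_fun hip v)

/-- `Hom_A(U^k, U)` is free over `B` if `B` is the endomorphism ring of `U`. -/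
theorem exists_equiv_dual_pi (hB : ∀ φ : U →ₗ[A] U, ∃! b : B, ∀ x, φ x = b • x) (k : ℕ) :
    Nonempty ((Fin k → B) ≃ₗ[B] ((Fin k → U) →ₗ[A] U)) := by
  have hbij : Function.Bijective (LinearMap.toSpanSingleton B (U →ₗ[A] U) LinearMap.id) := by
    constructor
    · intro b c hbc
      obtain ⟨d, -, hd⟩ := hB (b • LinearMap.id)
      rw [hd b fun _ => rfl, hd c fun x => LinearMap.congr_fun hbc x]
    · intro φ
      obtain ⟨b, hb, -⟩ := hB φ
      exact ⟨b, LinearMap.ext fun x => (hb x).symm⟩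
  exact ⟨(LinearEquiv.piCongrRight fun _ => LinearEquiv.ofBijective _ hbij).trans
    (LinearMap.lsum A (fun _ : Fin k => U) B)⟩

theorem InAdd.projective_dual (hB : ∀ φ : U →ₗ[A] U, ∃! b : B, ∀ x, φ x = b • x)
    (hV : InAdd A U V) : Module.Projective B (V →ₗ[A] U) := by
  obtain ⟨k, r, s, hrs⟩ := hV.exists_retraction (B := B)
  obtain ⟨e⟩ := exists_equiv_dual_pi hB k
  have := Module.Projective.of_equiv e
  exact Module.Projective.of_split s r hrs

theorem InAdd.finite_dual (hB : ∀ φ : U →ₗ[A] U, ∃! b : B, ∀ x, φ x = b • x)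
    (hV : InAdd A U V) : Module.Finite B (V →ₗ[A] U) := by
  obtain ⟨k, r, s, hrs⟩ := hV.exists_retraction (B := B)
  obtain ⟨e⟩ := exists_equiv_dual_pi hB k
  have := Module.Finite.equiv e
  exact Module.Finite.of_surjective r fun x => ⟨s x, LinearMap.congr_fun hrs x⟩

theorem InAdd.exists_eval (hB : ∀ φ : U →ₗ[A] U, ∃! b : B, ∀ x, φ x = b • x)
    (hV : InAdd A U V) (γ : (V →ₗ[A] U) →ₗ[B] U) : ∃ v, γ = evalMap B U v := by
  obtain ⟨k, i, p, hip⟩ := hV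
  -- The coordinate maps `proj j ∘ i` generate `V*` over `B`, so the values of `γ` on them,
  -- projected from `U^k` to `V`, give the point.
  refine ⟨p fun j => γ (LinearMap.proj j ∘ₗ i), LinearMap.ext fun g => ?_⟩
  choose b hb using fun j => (hB (g ∘ₗ p ∘ₗ LinearMap.single A (fun _ => U) j)).exists
  have hgp : ∀ u, g (p u) = ∑ j, b j • u j := fun u => by
    have hu : u = ∑ j, LinearMap.single A (fun _ => U) j (u j) := by
      ext j; simp [Finset.sum_apply, Pi.single_apply]
    conv_lhs => rw [hu]
    simp only [map_sum]
    exact Finset.sum_congr rfl fun j _ => hb j (u j)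
  have hg : g = ∑ j, b j • (LinearMap.proj j ∘ₗ i : V →ₗ[A] U) := by
    ext v
    have h1 := hgp (i v)
    rw [show p (i v) = v from LinearMap.congr_fun hip v] at h1
    simp [h1]
  rw [evalMap_apply, hgp]
  conv_lhs => rw [hg]
  simp

theorem InAdd.eq_zero (hV : InAdd A U V) {v : V} (hv : ∀ g : V →ₗ[A] U, g v = 0) : v = 0 := by
  obtain ⟨k, i, p, hip⟩ := hV
  have : i v = 0 := funext fun j => hv (LinearMap.proj j ∘ₗ i)
  rw [← LinearMap.id_apply (R := A) v, ← hip, LinearMap.comp_apply, this, map_zero]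

/-- Vanishing of `Ext¹` for the cokernel of the dual of the first map of an exact sequence in
`add U`. -/
theorem extVanish_one_of_exact (hB : ∀ φ : U →ₗ[A] U, ∃! b : B, ∀ x, φ x = b • x)
    {V₀ V₁ V₂ : Type u} [AddCommGroup V₀] [AddCommGroup V₁] [AddCommGroup V₂] [Module A V₀]
    [Module A V₁] [Module A V₂] (h₀ : InAdd A U V₀) (h₁ : InAdd A U V₁) (h₂ : InAdd A U V₂)
    {α : V₀ →ₗ[A] V₁} {β : V₁ →ₗ[A] V₂} (hαβ : Function.Exact α β)
    {Q : Type u} [AddCommGroup Q] [Module B Q] {q : (V₀ →ₗ[A] U) →ₗ[B] Q}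
    (hq : Function.Surjective q) (hαq : Function.Exact (dualMap B U α) q) :
    ExtVanish B Q U 1 := by
  have := h₀.projective_dual hB
  refine (isSES_ker_subtype hq).extVanish_right_one (extVanish_of_projective 1 le_rfl) fun φ => ?_
  let d := kerLift _ _ hαq
  obtain ⟨v, hv⟩ := h₁.exists_eval hB (φ ∘ₗ d)
  -- Maps factoring through `β` vanish after composition with `α`, so evaluation at `v` is zero on
  -- them and `β v` is undetected by maps to `U`.
  have hβ : β v = 0 := h₂.eq_zero fun g => by
    have h3 : d (g ∘ₗ β) = 0 := by
      ext x
      change g (β (α x)) = 0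
      rw [hαβ.apply_apply_eq_zero, map_zero]
    have h4 := LinearMap.congr_fun hv (g ∘ₗ β)
    rw [LinearMap.comp_apply, h3, map_zero] at h4
    exact h4.symm
  obtain ⟨w, rfl⟩ := (hαβ v).1 hβ
  refine ⟨evalMap B U w, ?_⟩
  ext ⟨z, hz⟩
  obtain ⟨g, rfl⟩ := (hαq z).1 hz
  exact (LinearMap.congr_fun hv g).symm

/-- The sequence `⋯ → V₁* → V₀* → U → 0` is a resolution by finitely generated projectives over `B`,
with augmentation evaluation at `η 1`. Functionals on each `Vᵢ*` are evaluations, so applying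
`Hom_B(-, U)` leads back to the exact coresolution of `A`. -/
theorem selforthogonal_and_end_of_coresolution
    (hB : ∀ φ : U →ₗ[A] U, ∃! b : B, ∀ x, φ x = b • x)
    (V : ℕ → ModuleCat.{u} A) (η : A →ₗ[A] V 0) (δ : ∀ i, V i →ₗ[A] V (i + 1))
    (hV : ∀ i, InAdd A U (V i)) (hη : Function.Injective η) (hηδ : Function.Exact η (δ 0))
    (hδ : ∀ i, Function.Exact (δ i) (δ (i + 1)))
    (hη' : Function.Surjective (dualMap B U η))
    (hηδ' : Function.Exact (dualMap B U (δ 0)) (dualMap B U η))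
    (hδ' : ∀ i, Function.Exact (dualMap B U (δ (i + 1))) (dualMap B U (δ i))) :
    Module.Finite B U ∧ (∀ φ : U →ₗ[B] U, ∃ a : A, ∀ x, φ x = a • x) ∧
      (∀ a : A, (∀ x : U, a • x = 0) → a = 0) ∧ ∀ i, 1 ≤ i → ExtVanish B U U i := by
  have hε : ∀ g : V 0 →ₗ[A] U, g ∘ₗ η = 0 ↔ g (η 1) = 0 := fun g =>
    ⟨fun h => LinearMap.congr_fun h 1, fun h => LinearMap.ext_ring h⟩
  have hεs : Function.Surjective (evalMap B U (η 1)) := fun u => by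
    obtain ⟨g, hg⟩ := hη' (LinearMap.toSpanSingleton A U u)
    exact ⟨g, by simpa using LinearMap.congr_fun hg 1⟩
  have hεe : Function.Exact (dualMap B U (δ 0)) (evalMap B U (η 1)) := fun g =>
    (hε g).symm.trans (hηδ' g)
  refine ⟨?_, ?_, ?_, ?_⟩
  · have := (hV 0).finite_dual hB
    exact Module.Finite.of_surjective _ hεs
  · intro φ
    obtain ⟨v, hv⟩ := (hV 0).exists_eval hB (φ ∘ₗ evalMap B U (η 1))
    have hv0 : δ 0 v = 0 := (hV 1).eq_zero fun g => by
      have h1 := LinearMap.congr_fun hv (g ∘ₗ δ 0)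
      simp only [LinearMap.comp_apply, evalMap_apply, hηδ.apply_apply_eq_zero, map_zero] at h1
      exact h1.symm
    obtain ⟨a, rfl⟩ := (hηδ v).1 hv0
    refine ⟨a, fun x => ?_⟩
    obtain ⟨g, rfl⟩ := hεs x
    have h1 := LinearMap.congr_fun hv g
    simp only [LinearMap.comp_apply, evalMap_apply] at h1 ⊢
    rw [h1, ← map_smul, ← map_smul, smul_eq_mul, mul_one]
  · intro a ha
    refine hη (((hV 0).eq_zero fun g => ?_).trans (map_zero η).symm)
    rw [← mul_one a, ← smul_eq_mul, map_smul, map_smul, ha]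
  · have hp : ∀ i, Module.Projective B (V i →ₗ[A] U) := fun i => (hV i).projective_dual hB
    -- These kernels are the syzygies of `U` from the second on; `U` itself and its first syzygy,
    -- whose presentations involve the augmentation, are treated separately below.
    have key : ∀ n i, ExtVanish B (LinearMap.ker (dualMap B U (δ i))) U (n + 1) := by
      intro n
      induction n with
      | zero =>
        intro i
        exact extVanish_one_of_exact hB (hV (i + 2)) (hV (i + 3)) (hV (i + 4)) (hδ (i + 2))
          (kerLift_surjective (hδ' i)) (exact_kerLift (hδ' i) (hδ' (i + 1)))
      | succ n ih =>
        intro i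
        have hs : IsSES (LinearMap.ker (dualMap B U (δ (i + 1)))).subtype
            (kerLift _ _ (hδ' i)) :=
          ⟨Submodule.subtype_injective _,
            exact_kerLift (hδ' i) (LinearMap.exact_subtype_ker_map _), kerLift_surjective _⟩
        have := hp (i + 2)
        exact hs.extVanish_right (ih (i + 1)) (extVanish_of_projective _ (by lia))
    have hs : IsSES (LinearMap.ker (dualMap B U (δ 0))).subtype (kerLift _ _ hεe) :=
      ⟨Submodule.subtype_injective _,
        exact_kerLift hεe (LinearMap.exact_subtype_ker_map _), kerLift_surjective _⟩
    intro i hi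
    obtain ⟨n, rfl⟩ := Nat.exists_eq_add_of_le' hi
    cases n with
    | zero => exact extVanish_one_of_exact hB (hV 0) (hV 1) (hV 2) (hδ 0) hεs hεe
    | succ n =>
      have := hp 0
      refine (isSES_ker_subtype hεs).extVanish_right ?_ (extVanish_of_projective _ (by lia))
      cases n with
      | zero =>
        exact extVanish_one_of_exact hB (hV 1) (hV 2) (hV 3) (hδ 1) (kerLift_surjective hεe)
          (exact_kerLift hεe (hδ' 0))
      | succ n =>
        have := hp 1
        exact hs.extVanish_right (key n 0) (extVanish_of_projective _ (by lia))

end Coresolution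

/-! ### Membership in `add-lim U` as a factorization property -/

section AddLim

variable {R : Type u} [Ring R] {U : Type u} [AddCommGroup U] [Module R U]
variable {M : Type u} [AddCommGroup M] [Module R M]

variable (U) in
/-- The map `f` factors through a finite power of `U`. -/
def FactorsThroughPow {X : Type u} [AddCommGroup X] [Module R X] (f : X →ₗ[R] M) : Prop :=
  ∃ (l : ℕ) (g : X →ₗ[R] (Fin l → U)) (h : (Fin l → U) →ₗ[R] M), h ∘ₗ g = f

variable (R U M) in
/-- Every map from a finitely generated module to `M` factors through a finite power of `U`. -/
def FactorsOnFinite : Prop :=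
  ∀ (X : Type u) [AddCommGroup X] [Module R X] [Module.Finite R X] (f : X →ₗ[R] M),
    FactorsThroughPow U f

theorem FactorsThroughPow.comp_left {X N : Type u} [AddCommGroup X] [Module R X] [AddCommGroup N]
    [Module R N] {f : X →ₗ[R] M} (hf : FactorsThroughPow U f) (p : M →ₗ[R] N) :
    FactorsThroughPow U (p ∘ₗ f) := by
  obtain ⟨l, g, h, rfl⟩ := hf
  exact ⟨l, g, p ∘ₗ h, rfl⟩

theorem FactorsThroughPow.comp_right {X Y : Type u} [AddCommGroup X] [Module R X] [AddCommGroup Y]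
    [Module R Y] {f : X →ₗ[R] M} (hf : FactorsThroughPow U f) (p : Y →ₗ[R] X) :
    FactorsThroughPow U (f ∘ₗ p) := by
  obtain ⟨l, g, h, rfl⟩ := hf
  exact ⟨l, g ∘ₗ p, h, rfl⟩

theorem factorsThroughPow_from_pow (k : ℕ) (f : (Fin k → U) →ₗ[R] M) : FactorsThroughPow U f :=
  ⟨k, LinearMap.id, f, rfl⟩

theorem factorsThroughPow_of_finite {ι : Type*} [Finite ι] {X : Type u} [AddCommGroup X]
    [Module R X] (g : X →ₗ[R] (ι → U)) (h : (ι → U) →ₗ[R] M) : FactorsThroughPow U (h ∘ₗ g) := by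
  obtain ⟨n, ⟨e⟩⟩ := Finite.exists_equiv_fin ι
  refine ⟨n, LinearMap.funLeft R U e.symm ∘ₗ g, h ∘ₗ LinearMap.funLeft R U e, ?_⟩
  ext x
  simp only [LinearMap.comp_apply]
  congr 1
  ext i
  simp [LinearMap.funLeft_apply]

theorem FactorsThroughPow.sub {X : Type u} [AddCommGroup X] [Module R X] {f f' : X →ₗ[R] M}
    (hf : FactorsThroughPow U f) (hf' : FactorsThroughPow U f') : FactorsThroughPow U (f - f') := by
  obtain ⟨l, g, h, rfl⟩ := hf
  obtain ⟨l', g', h', rfl⟩ := hf'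
  have := factorsThroughPow_of_finite
    ((LinearEquiv.sumArrowLequivProdArrow (Fin l) (Fin l') R U).symm.toLinearMap ∘ₗ g.prod g')
    ((h.coprod (-h')) ∘ₗ (LinearEquiv.sumArrowLequivProdArrow (Fin l) (Fin l') R U).toLinearMap)
  convert this using 1
  ext x
  simp [sub_eq_add_neg]

theorem FactorsOnFinite.of_isSummand {N : Type u} [AddCommGroup N] [Module R N]
    (hN : FactorsOnFinite R U N) (h : IsSummand R M N) : FactorsOnFinite R U M := by
  obtain ⟨i, p, hip⟩ := h
  intro X _ _ _ f
  have := (hN X (i ∘ₗ f)).comp_left p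
  rwa [← LinearMap.comp_assoc, hip, LinearMap.id_comp] at this

theorem factorsOnFinite_of_subsingleton [Subsingleton M] : FactorsOnFinite R U M :=
  fun _ _ _ _ _ => ⟨0, 0, 0, LinearMap.ext fun _ => Subsingleton.elim _ _⟩

theorem factorsOnFinite_self : FactorsOnFinite R U U := fun _ _ _ _ f =>
  ⟨1, LinearMap.pi fun _ => f, LinearMap.proj 0, rfl⟩

theorem factorsOnFinite_finsupp (Λ : Type u) : FactorsOnFinite R U (Λ →₀ U) := by
  intro X _ _ _ f
  obtain ⟨s, hs⟩ := Module.Finite.fg_top (R := R) (M := X)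
  classical
  let t : Finset Λ := s.biUnion fun x => (f x).support
  have ht : ∀ x, ∀ a ∉ t, f x a = 0 := by
    intro x
    have hx : x ∈ Submodule.span R (s : Set X) := hs ▸ Submodule.mem_top
    induction hx using Submodule.span_induction with
    | mem x hx =>
      intro a ha
      by_contra h
      exact ha (Finset.mem_biUnion.2 ⟨x, hx, Finsupp.mem_support_iff.2 h⟩)
    | zero => simp
    | add x y _ _ hx hy => intro a ha; simp [hx a ha, hy a ha]
    | smul r x _ hx => intro a ha; simp [hx a ha]
  have := factorsThroughPow_of_finite (LinearMap.pi fun a : t => Finsupp.lapply a.1 ∘ₗ f)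
    (∑ a : t, Finsupp.lsingle a.1 ∘ₗ LinearMap.proj a)
  convert this using 1
  ext x a
  simp only [LinearMap.comp_apply, LinearMap.sum_apply, Finsupp.finsetSum_apply,
    LinearMap.proj_apply, LinearMap.pi_apply, Finsupp.lapply_apply, Finsupp.lsingle_apply, Finsupp.single_apply]
  by_cases ha : a ∈ t
  · rw [Finset.sum_eq_single ⟨a, ha⟩]
    · simp
    · intro b _ hb
      exact if_neg fun h => hb (Subtype.ext h)
    · simp
  · rw [ht x a ha, Finset.sum_eq_zero]
    intro b _
    exact if_neg fun h : b.1 = a => ha (h ▸ b.2)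

/-- Over a noetherian ring finitely generated modules are finitely presented, so their maps to a
direct limit factor through one stage. -/
theorem InAddLim.factorsOnFinite [IsNoetherianRing R] (hM : InAddLim R U M) :
    FactorsOnFinite R U M := by
  obtain ⟨ι, _, _, _, _, k, f, hf, hs⟩ := hM
  refine FactorsOnFinite.of_isSummand (N := Module.DirectLimit (fun i => Fin (k i) → U) f) ?_ hs
  intro X _ _ _ φ
  obtain ⟨m, p, hp⟩ := Module.Finite.exists_fin' R X
  choose i x hx using fun j : Fin m =>
    Module.DirectLimit.exists_of (φ (p (Pi.single j 1)))
  obtain ⟨i₀, hi₀⟩ := Finite.exists_le i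
  let θ : (Fin m → R) →ₗ[R] (Fin (k i₀) → U) :=
    (Pi.basisFun R (Fin m)).constr ℕ fun j => f (i j) i₀ (hi₀ j) (x j)
  have hθ : Module.DirectLimit.of R ι (fun i => Fin (k i) → U) f i₀ ∘ₗ θ = φ ∘ₗ p := by
    refine (Pi.basisFun R (Fin m)).ext fun j => ?_
    rw [LinearMap.comp_apply, LinearMap.comp_apply, Module.Basis.constr_basis,
      Module.DirectLimit.of_f, hx, Pi.basisFun_apply]
  -- The lift `θ` need not respect the relations of `X`, but finitely many of them generate, and all
  -- of these die at a later stage.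
  obtain ⟨s, hs⟩ := IsNoetherian.noetherian (LinearMap.ker p)
  have hy : ∀ y : s, ∃ j, ∃ h : i₀ ≤ j, f i₀ j h (θ y) = 0 := fun y =>
    Module.DirectLimit.of.zero_exact <| by
      have h1 : p y.1 = 0 := (hs ▸ Submodule.subset_span y.2 : (y : Fin m → R) ∈ LinearMap.ker p)
      have h2 := LinearMap.congr_fun hθ y
      simpa [h1] using h2
  choose j hj hj0 using hy
  obtain ⟨j₀, hj₀⟩ := Finite.exists_le j
  obtain ⟨j₁, hj₁, hij⟩ := exists_ge_ge j₀ i₀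
  have hker : LinearMap.ker p ≤ LinearMap.ker (f i₀ j₁ hij ∘ₗ θ) := by
    rw [← hs, Submodule.span_le]
    intro y hy
    have h1 := hf.map_map (hj ⟨y, hy⟩) ((hj₀ ⟨y, hy⟩).trans hj₁) (θ y)
    rw [hj0, map_zero] at h1
    exact h1.symm
  obtain ⟨g, hg⟩ := exists_factor_of_ker_le hp (f i₀ j₁ hij ∘ₗ θ) fun x hx => hker hx
  refine ⟨k j₁, g, Module.DirectLimit.of R ι (fun i => Fin (k i) → U) f j₁, ?_⟩
  ext x
  obtain ⟨y, rfl⟩ := hp x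
  have h1 := LinearMap.congr_fun hg y
  have h2 := LinearMap.congr_fun hθ y
  simp only [LinearMap.comp_apply] at h1 h2 ⊢
  rw [h1, Module.DirectLimit.of_f, h2]

variable (R U M) in
/-- Finite powers of `U` with a map to `M`. -/
structure PowOver where
  /-- the exponent -/
  k : ℕ
  /-- the structure map -/
  φ : (Fin k → U) →ₗ[R] M

namespace PowOver

instance : SmallCategory (PowOver R U M) where
  Hom a b := { g : (Fin a.k → U) →ₗ[R] (Fin b.k → U) // b.φ ∘ₗ g = a.φ }
  id a := ⟨LinearMap.id, rfl⟩
  comp f g := ⟨g.1 ∘ₗ f.1, by rw [← LinearMap.comp_assoc, g.2, f.2]⟩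

theorem comp_val {a b c : PowOver R U M} (f : a ⟶ b) (g : b ⟶ c) : (f ≫ g).1 = g.1 ∘ₗ f.1 := rfl

/-- Upper bounds arise by factoring the map out of a finitely generated colimit: the direct sum of
two objects, or the coequalizer of two parallel maps. -/
theorem isFiltered [Module.Finite R U] (hM : FactorsOnFinite R U M) :
    IsFiltered (PowOver R U M) where
  nonempty := ⟨⟨0, 0⟩⟩
  cocone_objs a b := by
    obtain ⟨l, g, h, hgh⟩ := hM _ (a.φ.coprod b.φ)
    refine ⟨⟨l, h⟩, ⟨g ∘ₗ LinearMap.inl R _ _, ?_⟩, ⟨g ∘ₗ LinearMap.inr R _ _, ?_⟩, trivial⟩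
    · rw [← LinearMap.comp_assoc, hgh, LinearMap.coprod_inl]
    · rw [← LinearMap.comp_assoc, hgh, LinearMap.coprod_inr]
  cocone_maps a b f g := by
    have hle : LinearMap.range (f.1 - g.1) ≤ LinearMap.ker b.φ := by
      rintro _ ⟨x, rfl⟩
      have h1 := LinearMap.congr_fun f.2 x
      have h2 := LinearMap.congr_fun g.2 x
      simp only [LinearMap.comp_apply] at h1 h2
      simp [h1, h2]
    obtain ⟨l, s, h, hsh⟩ := hM _ ((LinearMap.range (f.1 - g.1)).liftQ b.φ hle)
    refine ⟨⟨l, h⟩, ⟨s ∘ₗ Submodule.mkQ _, ?_⟩, Subtype.ext ?_⟩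
    · rw [← LinearMap.comp_assoc, hsh, Submodule.liftQ_mkQ]
    · refine LinearMap.ext fun x => ?_
      simp only [comp_val, LinearMap.comp_apply]
      congr 1
      exact (Submodule.Quotient.eq _).2 ⟨x, rfl⟩

end PowOver

/-- `M` is the colimit of all powers of `U` mapping to it. A final functor from a directed set
replaces this filtered category by a directed system, so `M` is itself a direct limit and no summand
is needed. -/
theorem FactorsOnFinite.inAddLim [Module.Finite R U] (hM : FactorsOnFinite R U M) :
    InAddLim R U M := by
  have := PowOver.isFiltered hM
  obtain ⟨ι, _, _, _, F, _⟩ := IsFiltered.exists_directed (PowOver R U M)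
  classical
  let f : ∀ i j : ι, i ≤ j → (Fin (F.obj i).k → U) →ₗ[R] (Fin (F.obj j).k → U) :=
    fun i j h => (F.map (homOfLE h)).1
  have hf : DirectedSystem (fun i => Fin (F.obj i).k → U) fun i j h => f i j h := by
    constructor
    · intro i x
      change (F.map (𝟙 i)).1 x = x
      rw [F.map_id]
      rfl
    · intro l j i hij hjl x
      change (F.map (homOfLE hjl)).1 ((F.map (homOfLE hij)).1 x) = (F.map (homOfLE _)).1 x
      rw [← homOfLE_comp hij hjl, F.map_comp]
      rfl
  refine ⟨ι, inferInstance, inferInstance, inferInstance, inferInstance, fun i => (F.obj i).k,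
    f, hf, ?_⟩
  let L : Module.DirectLimit (fun i => Fin (F.obj i).k → U) f →ₗ[R] M :=
    Module.DirectLimit.lift R ι _ f (fun i => (F.obj i).φ)
      fun i j h x => LinearMap.congr_fun (F.map (homOfLE h)).2 x
  have hcof := (Functor.final_iff_of_isFiltered F).1 inferInstance
  have hsurj : Function.Surjective L := by
    intro m
    obtain ⟨l, g, h, hgh⟩ := hM R (LinearMap.toSpanSingleton R M m)
    obtain ⟨c, ⟨t⟩⟩ := hcof.1 ⟨l, h⟩
    refine ⟨Module.DirectLimit.of R ι _ f c (t.1 (g 1)), ?_⟩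
    rw [Module.DirectLimit.lift_of]
    have h1 := LinearMap.congr_fun t.2 (g 1)
    have h2 := LinearMap.congr_fun hgh 1
    simp only [LinearMap.comp_apply] at h1 h2
    rw [h1, h2]
    simp
  have hinj : Function.Injective L := by
    rw [injective_iff_map_eq_zero]
    intro x hx
    obtain ⟨i, y, rfl⟩ := Module.DirectLimit.exists_of x
    rw [Module.DirectLimit.lift_of] at hx
    -- An element `y` mapping to zero in `M` is killed by a morphism to another power of `U`, namely
    -- one through the quotient by `R y`; finality carries this into the directed system.
    obtain ⟨l, g, h, hgh⟩ := hM _ ((Submodule.span R {y}).liftQ (F.obj i).φ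
      (by rw [Submodule.span_singleton_le_iff_mem]; exact hx))
    let s : F.obj i ⟶ ⟨l, h⟩ := ⟨g ∘ₗ Submodule.mkQ _, by
      rw [← LinearMap.comp_assoc, hgh, Submodule.liftQ_mkQ]⟩
    obtain ⟨c, ⟨t⟩⟩ := hcof.1 ⟨l, h⟩
    obtain ⟨j, hij, hcj⟩ := exists_ge_ge i c
    obtain ⟨j', q, hq⟩ := hcof.2 (F.map (homOfLE hij)) (s ≫ t ≫ F.map (homOfLE hcj))
    have h0 : s.1 y = 0 := by
      have : (Submodule.span R {y}).mkQ y = 0 :=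
        (Submodule.Quotient.mk_eq_zero _).2 (Submodule.mem_span_singleton_self y)
      change g ((Submodule.span R {y}).mkQ y) = 0
      rw [this, map_zero]
    have h1 : f j j' (leOfHom q) (f i j hij y) = 0 := by
      have h2 := LinearMap.congr_fun (congrArg Subtype.val hq) y
      simp only [PowOver.comp_val, LinearMap.comp_apply, h0, map_zero] at h2
      exact h2
    rw [← Module.DirectLimit.of_f (hij := hij), ← Module.DirectLimit.of_f (hij := leOfHom q), h1,
      map_zero]
  let e := LinearEquiv.ofBijective L ⟨hinj, hsurj⟩
  exact ⟨e.symm.toLinearMap, e.toLinearMap, LinearMap.ext fun x => e.apply_symm_apply x⟩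

theorem inAddLim_iff [IsNoetherianRing R] [Module.Finite R U] :
    InAddLim R U M ↔ FactorsOnFinite R U M :=
  ⟨InAddLim.factorsOnFinite, FactorsOnFinite.inAddLim⟩

end AddLim

/-! ### Left approximations by powers of `U` and maps to injective modules -/

section Approximation

variable {R B : Type u} [Ring R] [Ring B]
  {U : Type u} [AddCommGroup U] [Module R U] [Module B U] [SMulCommClass R B U]
variable {X M E : Type u} [AddCommGroup X] [Module R X] [AddCommGroup M] [Module R M]
  [AddCommGroup E] [Module R E]

/-- The map `a : X → U^l` is a left approximation of `X` by powers of `U`. -/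
def IsLeftApprox {l : ℕ} (a : X →ₗ[R] (Fin l → U)) : Prop :=
  ∀ g : X →ₗ[R] U, ∃ c : (Fin l → U) →ₗ[R] U, c ∘ₗ a = g

-- Finitely many generators of `Hom(X, U)` over `B` are the components of the approximation.
variable (B U X) in
theorem exists_isLeftApprox [IsNoetherianRing B] [Module.Finite B U] [Module.Finite R X] :
    ∃ (l : ℕ) (a : X →ₗ[R] (Fin l → U)), IsLeftApprox a := by
  have := finite_dual (A := R) (B := B) (U := U) X
  obtain ⟨l, p, hp⟩ := Module.Finite.exists_fin' B (X →ₗ[R] U)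
  refine ⟨l, LinearMap.pi fun i => p (Pi.single i 1), fun g => ?_⟩
  obtain ⟨b, rfl⟩ := hp g
  refine ⟨∑ i, b i • LinearMap.proj i, ?_⟩
  ext x
  have hb : b = ∑ i, b i • Pi.single i (1 : B) := by
    ext j; simp [Finset.sum_apply, Pi.single_apply]
  conv_rhs => rw [hb]
  simp

theorem IsLeftApprox.eq_zero {l : ℕ} {a : X →ₗ[R] (Fin l → U)} (ha : IsLeftApprox a)
    (g : X →ₗ[R] U) {x : X} (hx : a x = 0) : g x = 0 := by
  obtain ⟨c, rfl⟩ := ha g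
  simp [hx]

theorem exists_extend_of_injective [Module.Injective R E] {i : X →ₗ[R] M}
    (hi : Function.Injective i) (f : X →ₗ[R] E) : ∃ g : M →ₗ[R] E, g ∘ₗ i = f := by
  obtain ⟨g, hg⟩ := Module.Injective.out i hi f
  exact ⟨g, LinearMap.ext hg⟩

theorem factorsThroughPow_of_ker_le [Module.Injective R E] {l : ℕ} (a : X →ₗ[R] (Fin l → U))
    (f : X →ₗ[R] E) (h : ∀ x, a x = 0 → f x = 0) : FactorsThroughPow U f := by
  obtain ⟨f', rfl⟩ := exists_factor_of_ker_le a.surjective_rangeRestrict f fun x hx =>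
    h x (Subtype.ext_iff.1 hx)
  obtain ⟨g, rfl⟩ := exists_extend_of_injective (LinearMap.range a).subtype_injective f'
  exact ⟨l, a, g, rfl⟩

/-- If every finitely generated module without maps to `U` has no maps to the injective module `E`,
then maps from finitely generated modules to `E` factor through powers of `U`. -/
theorem factorsOnFinite_of_hom_eq_zero [IsNoetherianRing R] [IsNoetherianRing B]
    [Module.Finite B U] [Module.Injective R E] (hself : ExtVanish R U U 1)
    (hid : ∀ (W : Type u) [AddCommGroup W] [Module R W], ExtVanish R W U 2)
    (hE : ∀ (M : Type u) [AddCommGroup M] [Module R M] [Module.Finite R M],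
      (∀ g : M →ₗ[R] U, g = 0) → ∀ f : M →ₗ[R] E, f = 0) :
    FactorsOnFinite R U E := by
  intro X _ _ _ f
  obtain ⟨l, a, ha⟩ := exists_isLeftApprox (R := R) B U X
  refine factorsThroughPow_of_ker_le a f fun x hx => ?_
  -- With this vanishing, maps from `ker a` to `U` extend to `X`, factor through `a`, and are
  -- therefore zero.
  have hr : ExtVanish R (LinearMap.range a) U 1 :=
    (isSES_subtype_mkQ (LinearMap.range a)).extVanish_left (hself.pi l) (hid _)
  refine LinearMap.congr_fun (hE (LinearMap.ker a) (fun g => ?_)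
    (f ∘ₗ (LinearMap.ker a).subtype)) ⟨x, hx⟩
  obtain ⟨g', rfl⟩ := (isSES_rangeRestrict a).exists_extend hr g
  exact LinearMap.ext fun y => ha.eq_zero g' y.2

theorem FactorsOnFinite.hom_eq_zero (hE : FactorsOnFinite R U E) [Module.Finite R M]
    (hM : ∀ g : M →ₗ[R] U, g = 0) (f : M →ₗ[R] E) : f = 0 := by
  obtain ⟨l, g, h, rfl⟩ := hE M f
  have : g = 0 := LinearMap.ext fun x => funext fun i =>
    LinearMap.congr_fun (hM (LinearMap.proj i ∘ₗ g)) x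
  rw [this, LinearMap.comp_zero]

/-- The kernel of a left approximation of a module `X` with `Ext¹(X, U) = 0` has grade at least
two. -/
theorem IsLeftApprox.grade_ker [IsNoetherianRing R] [IsNoetherianRing B]
    [Module.Finite B U] [SMulCommClass B R U] (hR : IsDualizing R B U) (hB : IsDualizing B R U)
    [Module.Finite R X] (hX : ExtVanish R X U 1) {l : ℕ} {a : X →ₗ[R] (Fin l → U)}
    (ha : IsLeftApprox a) :
    (∀ g : LinearMap.ker a →ₗ[R] U, g = 0) ∧ ExtVanish R (LinearMap.ker a) U 1 := by
  have := finite_dual (A := R) (B := B) (U := U) X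
  let ev : X →ₗ[R] ((X →ₗ[R] U) →ₗ[B] U) :=
    { toFun := fun x => evalMap B U x
      map_add' := fun x y => LinearMap.ext fun g => map_add g x y
      map_smul' := fun r x => LinearMap.ext fun g => map_smul g r x }
  -- The kernel of an approximation is the kernel of `X → X**`, which is onto here. The bidual,
  -- being a dual, has no higher `Ext` into `U`.
  have hs : IsSES (LinearMap.ker a).subtype ev := by
    refine ⟨Submodule.subtype_injective _, fun x => ?_, fun γ => ?_⟩
    · constructor
      · intro hx
        refine ⟨⟨x, ?_⟩, rfl⟩
        exact funext fun i =>
          LinearMap.congr_fun hx (LinearMap.proj (R := R) (φ := fun _ => U) i ∘ₗ a)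
      · rintro ⟨y, rfl⟩
        exact LinearMap.ext fun g => ha.eq_zero g y.2
    · obtain ⟨x, rfl⟩ := hR.exists_eval hX γ
      exact ⟨x, rfl⟩
  refine ⟨fun g => ?_, hs.extVanish_left hX (hB.extVanish_dual 2 (by lia))⟩
  obtain ⟨g', rfl⟩ := hs.exists_extend (hB.extVanish_dual 1 le_rfl) g
  exact LinearMap.ext fun y => ha.eq_zero g' y.2

/-- Lift `f` to a map from a free cover `F` of `M` to `V₀`, restricting to a map from the kernel `K`
to `V₁`. The latter passes through some `U^l` and, as `Ext¹(M, U) = 0`, extends to `F`. The lift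
minus this extension descends to a map `M → V₀`, which is zero, so the lift comes from `V₁`. -/
theorem hom_eq_zero_of_isSES [IsNoetherianRing R] {V₁ V₀ : Type u} [AddCommGroup V₁]
    [AddCommGroup V₀] [Module R V₁] [Module R V₀] {d : V₁ →ₗ[R] V₀} {ε : V₀ →ₗ[R] E}
    (hdε : IsSES d ε) (h1 : FactorsOnFinite R U V₁) (h0 : FactorsOnFinite R U V₀)
    [Module.Finite R M] (hM : ∀ g : M →ₗ[R] U, g = 0) (hM1 : ExtVanish R M U 1)
    (f : M →ₗ[R] E) : f = 0 := by
  obtain ⟨k, p, hp⟩ := Module.Finite.exists_fin' R M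
  obtain ⟨θ, hθ⟩ := Module.projective_lifting_property ε (f ∘ₗ p) hdε.surj
  have hκ : ∀ x : LinearMap.ker p, ∃ v, d v = θ x := fun x =>
    (hdε.exact (θ x)).1 <| by
      have h1 := LinearMap.congr_fun hθ x
      have h2 : p x = 0 := x.2
      simpa [h2] using h1
  let κ : LinearMap.ker p →ₗ[R] V₁ :=
    (LinearEquiv.ofInjective d hdε.inj).symm.toLinearMap ∘ₗ
      (θ ∘ₗ (LinearMap.ker p).subtype).codRestrict (LinearMap.range d) hκ
  have hdκ : ∀ x : LinearMap.ker p, d (κ x) = θ x := fun x => by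
    have := (LinearEquiv.ofInjective d hdε.inj).apply_symm_apply
      ((θ ∘ₗ (LinearMap.ker p).subtype).codRestrict (LinearMap.range d) hκ x)
    exact congrArg Subtype.val this
  obtain ⟨l, g, h, hgh⟩ := h1 _ κ
  choose ψ hψ using fun i : Fin l =>
    (isSES_ker_subtype hp).exists_extend hM1 (LinearMap.proj i ∘ₗ g)
  have hψg : ∀ x : LinearMap.ker p, LinearMap.pi ψ (x : Fin k → R) = g x := fun x =>
    funext fun i => LinearMap.congr_fun (hψ i) x
  obtain ⟨χ, hχ⟩ := exists_factor_of_ker_le hp (θ - d ∘ₗ h ∘ₗ LinearMap.pi ψ) fun x hx => by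
    have h2 := hψg ⟨x, hx⟩
    have h3 := LinearMap.congr_fun hgh ⟨x, hx⟩
    have h4 := hdκ ⟨x, hx⟩
    simp only [LinearMap.comp_apply] at h2 h3 h4
    simp only [LinearMap.sub_apply, LinearMap.comp_apply, h2, h3, h4, sub_self]
  rw [h0.hom_eq_zero hM χ, LinearMap.zero_comp, eq_comm, sub_eq_zero] at hχ
  ext m
  obtain ⟨x, rfl⟩ := hp m
  have h5 := LinearMap.congr_fun hθ x
  simp only [LinearMap.comp_apply] at h5
  rw [← h5, hχ]
  exact hdε.exact.apply_apply_eq_zero _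

/-- The canonical map from a direct sum of copies of `U` to `E`. -/
def evalSum (R U E : Type u) [Ring R] [AddCommGroup U] [Module R U] [AddCommGroup E] [Module R E] :
    ((U →ₗ[R] E) →₀ U) →ₗ[R] E :=
  Finsupp.lsum ℕ fun φ => φ

theorem exists_lift_evalSum {l : ℕ} (h : (Fin l → U) →ₗ[R] E) :
    ∃ h' : (Fin l → U) →ₗ[R] ((U →ₗ[R] E) →₀ U), evalSum R U E ∘ₗ h' = h := by
  refine ⟨∑ i, Finsupp.lsingle (h ∘ₗ LinearMap.single R (fun _ => U) i) ∘ₗ LinearMap.proj i, ?_⟩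
  ext i u
  simp only [LinearMap.comp_apply, LinearMap.sum_apply, map_sum, LinearMap.proj_apply, evalSum,
    Finsupp.lsingle_apply, Finsupp.lsum_single]
  rw [Finset.sum_eq_single i]
  · simp
  · intro j _ hj
    simp [hj]
  · simp

/-- If an injective module `E` has no nonzero maps from finitely generated modules of grade at
least two, then the kernel of the canonical map `U^(Λ) → E` is a direct limit of powers of `U`. -/
theorem factorsOnFinite_ker_evalSum [IsNoetherianRing R] [IsNoetherianRing B]
    [Module.Finite R U] [Module.Finite B U] [SMulCommClass B R U] [Module.Injective R E]
    (hR : IsDualizing R B U) (hB : IsDualizing B R U)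
    (hE : ∀ (M : Type u) [AddCommGroup M] [Module R M] [Module.Finite R M],
      (∀ g : M →ₗ[R] U, g = 0) → ExtVanish R M U 1 → ∀ f : M →ₗ[R] E, f = 0) :
    FactorsOnFinite R U (LinearMap.ker (evalSum R U E)) := by
  set ε := evalSum R U E
  intro X _ _ _ f
  obtain ⟨m, g, i, hgi⟩ := factorsOnFinite_finsupp (U →ₗ[R] E) X ((LinearMap.ker ε).subtype ∘ₗ f)
  -- The map `f` has image in a finite part `U^m` and so passes through the finitely generated
  -- module `K`; it suffices to factor `j : K → ker ε`.
  let K := LinearMap.ker (ε ∘ₗ i)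
  let j : K →ₗ[R] LinearMap.ker ε :=
    (i ∘ₗ K.subtype).codRestrict (LinearMap.ker ε) fun x => x.2
  have hgK : ∀ x, g x ∈ K := fun x => by
    change ε (i (g x)) = 0
    rw [← LinearMap.comp_apply i g, hgi]
    exact (f x).2
  have hf : f = j ∘ₗ g.codRestrict K hgK := by
    ext1 x
    exact Subtype.ext (LinearMap.congr_fun hgi x).symm
  rw [hf]
  refine FactorsThroughPow.comp_right ?_ _
  obtain ⟨l, a, ha⟩ := exists_isLeftApprox (R := R) B U K
  -- The cokernel of `b` is the pushout of `a` and the inclusion `K → U^m`. Since maps `K → U`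
  -- factor through `a`, this pushout has no `Ext¹` into `U`, so the kernel of its own approximation
  -- has grade at least two.
  let b : K →ₗ[R] (Fin l → U) × (Fin m → U) := a.prod (-K.subtype)
  have hb : Function.Injective b := fun x y hxy => by
    have := congrArg Prod.snd hxy
    exact Subtype.ext (neg_injective this)
  have hself : ExtVanish R U U 1 := hB.extVanish_self 1 le_rfl
  have hprod : ExtVanish R ((Fin l → U) × (Fin m → U)) U 1 :=
    (IsSES.mk LinearMap.inl_injective .inl_snd Prod.snd_surjective :
      IsSES (LinearMap.inl R (Fin l → U) (Fin m → U)) (LinearMap.snd R _ _)).extVanish_mid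
      (hself.pi l) (hself.pi m)
  have hW : ExtVanish R (((Fin l → U) × (Fin m → U)) ⧸ LinearMap.range b) U 1 := by
    refine (isSES_mkQ_range hb).extVanish_right_one hprod fun φ => ?_
    obtain ⟨c, rfl⟩ := ha φ
    exact ⟨c ∘ₗ LinearMap.fst R _ _, rfl⟩
  let w : (((Fin l → U) × (Fin m → U)) ⧸ LinearMap.range b) →ₗ[R] E :=
    (LinearMap.range b).liftQ (ε ∘ₗ i ∘ₗ LinearMap.snd R _ _) <| by
      rintro _ ⟨x, rfl⟩
      change ε (i (-(x : Fin m → U))) = 0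
      rw [map_neg, map_neg, neg_eq_zero]
      exact x.2
  have hw : FactorsThroughPow U w := by
    obtain ⟨q, aW, haW⟩ :=
      exists_isLeftApprox (R := R) B U (((Fin l → U) × (Fin m → U)) ⧸ LinearMap.range b)
    obtain ⟨h1, h2⟩ := haW.grade_ker hR hB hW
    exact factorsThroughPow_of_ker_le aW w fun x hx =>
      LinearMap.congr_fun (hE _ h1 h2 (w ∘ₗ (LinearMap.ker aW).subtype)) ⟨x, hx⟩
  obtain ⟨q, s, h, hsh⟩ := hw
  obtain ⟨h', rfl⟩ := exists_lift_evalSum h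
  let χ : (Fin l → U) × (Fin m → U) →ₗ[R] ((U →ₗ[R] E) →₀ U) :=
    h' ∘ₗ s ∘ₗ (LinearMap.range b).mkQ
  have hχ : ∀ u v, ε (χ (u, v)) = ε (i v) := fun u v =>
    LinearMap.congr_fun hsh ((LinearMap.range b).mkQ (u, v))
  have hχb : ∀ x : K, χ (a x, 0) = χ (0, (x : Fin m → U)) := fun x => by
    rw [← sub_eq_zero, ← map_sub]
    have h1 : ((a x, 0) - (0, (x : Fin m → U)) : (Fin l → U) × (Fin m → U)) = b x :=
      Prod.ext (sub_zero _) (zero_sub _)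
    have h2 : (LinearMap.range b).mkQ (b x) = 0 :=
      (Submodule.Quotient.mk_eq_zero _).2 ⟨x, rfl⟩
    rw [h1]
    change h' (s ((LinearMap.range b).mkQ (b x))) = 0
    rw [h2, map_zero, map_zero]
  let χ₁ : (Fin l → U) →ₗ[R] LinearMap.ker ε :=
    (χ ∘ₗ LinearMap.inl R _ _).codRestrict _ fun u => by
      simp [hχ]
  let χ₂ : (Fin m → U) →ₗ[R] LinearMap.ker ε :=
    (χ ∘ₗ LinearMap.inr R _ _ - i).codRestrict _ fun u => by
      simp [hχ]
  -- The two restrictions of `χ` agree on `K`, so they cancel in the difference and leave `i` on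
  -- `K`.
  have hj : j = χ₁ ∘ₗ a - χ₂ ∘ₗ K.subtype := by
    ext1 x
    refine Subtype.ext ?_
    change i x = χ (a x, 0) - (χ (0, (x : Fin m → U)) - i x)
    rw [hχb, sub_sub_cancel]
  rw [hj]
  exact ((factorsThroughPow_from_pow l χ₁).comp_right a).sub
    ((factorsThroughPow_from_pow m χ₂).comp_right K.subtype)

/-- Any map `R → E` extends along `R → U^k` by injectivity, so every element of `E` is a sum of
values of maps from `U`. -/
theorem evalSum_surjective [Module.Injective R E] {k : ℕ} {j : R →ₗ[R] (Fin k → U)}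
    (hj : Function.Injective j) : Function.Surjective (evalSum R U E) := by
  intro e
  obtain ⟨h, hh⟩ := exists_extend_of_injective hj (LinearMap.toSpanSingleton R E e)
  obtain ⟨h', rfl⟩ := exists_lift_evalSum h
  exact ⟨h' (j 1), by simpa using LinearMap.congr_fun hh 1⟩

end Approximation

/-! ### `U`-limit dimension at most zero or one -/

section LimDim

variable {R : Type u} [Ring R] {U : Type u} [AddCommGroup U] [Module R U]
variable {E : Type u} [AddCommGroup E] [Module R E]

theorem limDim_le_iff (n : ℕ) :
    limDim R U E ≤ n ↔ ∃ m ≤ n, HasAddLimResolution R U E m := by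
  constructor
  · intro h
    have h1 : limDim R U E < ((n + 1 : ℕ) : ℕ∞) :=
      h.trans_lt (by exact_mod_cast Nat.lt_succ_self n)
    rw [limDim, iInf_lt_iff] at h1
    obtain ⟨m, hm⟩ := h1
    rw [iInf_lt_iff] at hm
    obtain ⟨hm, hmn⟩ := hm
    exact ⟨m, by exact_mod_cast Nat.lt_succ_iff.1 (by exact_mod_cast hmn), hm⟩
  · rintro ⟨m, hmn, hm⟩
    exact (iInf₂_le m hm).trans (by exact_mod_cast hmn)

theorem hasAddLimResolution_one {V₁ V₀ : Type u} [AddCommGroup V₁]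
    [AddCommGroup V₀] [Module R V₁] [Module R V₀] {d : V₁ →ₗ[R] V₀} {ε : V₀ →ₗ[R] E}
    (h : IsSES d ε) (h1 : InAddLim R U V₁) (h0 : InAddLim R U V₀) :
    HasAddLimResolution R U E 1 := by
  let V : ℕ → ModuleCat.{u} R
    | 0 => ModuleCat.of R V₀
    | 1 => ModuleCat.of R V₁
    | _ + 2 => ModuleCat.of R PUnit
  let D : ∀ i, V (i + 1) →ₗ[R] V i
    | 0 => d
    | _ + 1 => 0
  refine ⟨V, D, ε, ?_, ?_, h.surj, h.exact, ?_⟩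
  · intro i hi
    interval_cases i
    · exact h0
    · exact h1
  · intro i hi
    obtain ⟨j, rfl⟩ := Nat.exists_eq_add_of_le' hi
    exact inferInstanceAs (Subsingleton PUnit)
  · rintro (_ | i)
    · intro (x : V₁)
      refine ⟨fun hx => ⟨PUnit.unit, (h.inj (hx.trans (map_zero d).symm)).symm⟩, ?_⟩
      rintro ⟨y, rfl⟩
      exact map_zero d
    · intro x
      exact ⟨fun _ => ⟨PUnit.unit, Subsingleton.elim (α := PUnit) _ _⟩, fun _ => rfl⟩

theorem limDim_le_one_iff [IsNoetherianRing R] [Module.Finite R U] :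
    limDim R U E ≤ 1 ↔ ∃ (V₁ V₀ : ModuleCat.{u} R) (d : V₁ →ₗ[R] V₀) (ε : V₀ →ₗ[R] E),
      IsSES d ε ∧ FactorsOnFinite R U V₁ ∧ FactorsOnFinite R U V₀ := by
  have h1 : ((1 : ℕ) : ℕ∞) = 1 := rfl
  rw [← h1, limDim_le_iff]
  constructor
  · rintro ⟨m, hm, V, d, ε, hV, hV', hε, hdε, hd⟩
    refine ⟨V 1, V 0, d 0, ε, ⟨?_, hdε, hε⟩, ?_, (hV 0 (Nat.zero_le _)).factorsOnFinite⟩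
    · have := hV' 2 (by lia)
      rw [injective_iff_map_eq_zero]
      intro x hx
      obtain ⟨y, rfl⟩ := (hd 0 x).1 hx
      rw [Subsingleton.elim y 0, map_zero]
    · rcases Nat.lt_or_ge m 1 with hm | hm
      · have := hV' 1 hm
        exact factorsOnFinite_of_subsingleton
      · exact (hV 1 hm).factorsOnFinite
  · rintro ⟨V₁, V₀, d, ε, h, h1, h0⟩
    exact ⟨1, le_rfl, hasAddLimResolution_one h h1.inAddLim h0.inAddLim⟩

theorem limDim_le_zero_iff [IsNoetherianRing R] [Module.Finite R U] :
    limDim R U E ≤ 0 ↔ InAddLim R U E := by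
  have h1 : ((0 : ℕ) : ℕ∞) = 0 := rfl
  rw [← h1, limDim_le_iff]
  constructor
  · rintro ⟨m, hm, V, d, ε, hV, hV', hε, hdε, -⟩
    have := hV' 1 (by lia)
    have hinj : Function.Injective ε := by
      rw [injective_iff_map_eq_zero]
      intro x hx
      obtain ⟨y, rfl⟩ := (hdε x).1 hx
      rw [Subsingleton.elim y 0, map_zero]
    let e := LinearEquiv.ofBijective ε ⟨hinj, hε⟩
    exact ((hV 0 (Nat.zero_le _)).factorsOnFinite.of_isSummand
      ⟨e.symm.toLinearMap, e.toLinearMap, LinearMap.ext fun x => e.apply_symm_apply x⟩).inAddLim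
  · intro h
    let V : ℕ → ModuleCat.{u} R
      | 0 => ModuleCat.of R E
      | _ + 1 => ModuleCat.of R PUnit
    have hV : ∀ i, Subsingleton (V (i + 1)) := fun i => inferInstanceAs (Subsingleton PUnit)
    refine ⟨0, le_rfl, V, fun _ => 0, LinearMap.id, ?_, ?_, fun x => ⟨x, rfl⟩, ?_, ?_⟩
    · intro i hi
      obtain rfl := Nat.le_zero.1 hi
      exact h
    · intro i hi
      obtain ⟨j, rfl⟩ := Nat.exists_eq_add_of_le' hi
      exact hV j
    · intro (x : E)
      exact ⟨fun hx => ⟨0, hx.symm⟩, fun ⟨_, hy⟩ => hy.symm⟩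
    · intro i x
      exact ⟨fun _ => ⟨0, (hV i).elim _ _⟩, fun _ => rfl⟩

end LimDim

/-! ### Submodule-closure and maps to the minimal injective resolution -/

section Essential

variable {R : Type u} [Ring R] {U : Type u} [AddCommGroup U] [Module R U]
variable {M E : Type u} [AddCommGroup M] [Module R M] [AddCommGroup E] [Module R E]

theorem IsEssential.eq_zero {N : Submodule R E} (hN : IsEssential R N) (f : M →ₗ[R] E)
    (h : ∀ (X : Submodule R M) (g : X →ₗ[R] N), g = 0) : f = 0 := by
  by_contra hf
  refine hN (LinearMap.range f) (fun h0 => hf (LinearMap.range_eq_bot.1 h0)) ?_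
  rw [eq_bot_iff]
  rintro _ ⟨hx, m, rfl⟩
  exact congrArg Subtype.val (LinearMap.congr_fun
    (h (N.comap f) ((f ∘ₗ Submodule.subtype _).codRestrict N fun x => x.2)) ⟨m, hx⟩)

theorem hom_eq_zero_of_essential {η : U →ₗ[R] E} (hη : Function.Injective η)
    (hess : IsEssential R (LinearMap.range η)) (h : ∀ (X : Submodule R M) (g : X →ₗ[R] U), g = 0)
    (f : M →ₗ[R] E) : f = 0 := by
  refine hess.eq_zero f fun X g => ?_
  have h1 := h X ((LinearEquiv.ofInjective η hη).symm.toLinearMap ∘ₗ g)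
  ext x
  have h2 := LinearMap.congr_fun h1 x
  have h3 : g x = 0 := (LinearEquiv.ofInjective η hη).symm.map_eq_zero_iff.1 h2
  rw [h3]
  rfl

theorem hom_submodule_eq_zero [Module.Injective R E] (h : ∀ f : M →ₗ[R] E, f = 0)
    (X : Submodule R M) (g : X →ₗ[R] E) : g = 0 := by
  obtain ⟨f, rfl⟩ := exists_extend_of_injective X.subtype_injective g
  rw [h f, LinearMap.zero_comp]

/-- The class `𝒳` is closed under submodules iff no module in `𝒳` has a nonzero map to the
injective envelope `E` of `U`, where `𝒳` is the class of the finitely generated modules without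
maps to `U`. -/
theorem submoduleClosed_one_iff [IsNoetherianRing R] {𝒳 : ModuleCat.{u} R → Prop}
    (h𝒳 : ∀ M, 𝒳 M ↔ Module.Finite R M ∧ ∀ g : M →ₗ[R] U, g = 0) [Module.Injective R E]
    {η : U →ₗ[R] E} (hη : Function.Injective η) (hess : IsEssential R (LinearMap.range η)) :
    SubmoduleClosed R 𝒳 ↔ ∀ (M : Type u) [AddCommGroup M] [Module R M] [Module.Finite R M],
      (∀ g : M →ₗ[R] U, g = 0) → ∀ f : M →ₗ[R] E, f = 0 := by
  constructor
  · intro h M _ _ _ hM f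
    refine hom_eq_zero_of_essential hη hess (fun X g => ?_) f
    by_cases hX : X = ⊥
    · subst hX
      exact LinearMap.ext fun x => by rw [Subsingleton.elim x 0, map_zero, map_zero]
    · exact ((h𝒳 _).1 (h (ModuleCat.of R M) ((h𝒳 _).2 ⟨inferInstanceAs (Module.Finite R M), hM⟩)
        X hX)).2 g
  · intro h M hM X _
    obtain ⟨h1, h2⟩ := (h𝒳 _).1 hM
    refine (h𝒳 _).2 ⟨inferInstanceAs (Module.Finite R X), fun g => ?_⟩
    have h3 := hom_submodule_eq_zero (h M h2) X (η ∘ₗ g)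
    ext x
    exact hη ((LinearMap.congr_fun h3 x).trans (map_zero η).symm)

/-- Maps to `E` are controlled by `Hom(X, U)` for submodules `X`, as `U` is essential in `E`. Maps
to `E₁` are controlled by `Hom(X, im α)`, whose elements lift to `E` exactly up to `Ext¹(X, U)`. -/
theorem submoduleClosed_two_iff [IsNoetherianRing R] {𝒳 : ModuleCat.{u} R → Prop}
    (h𝒳 : ∀ M, 𝒳 M ↔ Module.Finite R M ∧ (∀ g : M →ₗ[R] U, g = 0) ∧ ExtVanish R M U 1)
    {E₁ : Type u} [AddCommGroup E₁] [Module R E₁]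
    [Module.Injective R E] [Module.Injective R E₁]
    {η : U →ₗ[R] E} (hη : Function.Injective η) (hess : IsEssential R (LinearMap.range η))
    {α : E →ₗ[R] E₁} (hηα : Function.Exact η α) (hessα : IsEssential R (LinearMap.range α)) :
    SubmoduleClosed R 𝒳 ↔ ∀ (M : Type u) [AddCommGroup M] [Module R M] [Module.Finite R M],
      (∀ g : M →ₗ[R] U, g = 0) → ExtVanish R M U 1 → ∀ f : M →ₗ[R] E × E₁, f = 0 := by
  have hs : IsSES η α.rangeRestrict := by
    refine ⟨hη, ?_, α.surjective_rangeRestrict⟩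
    rw [LinearMap.exact_iff, LinearMap.ker_rangeRestrict, hηα.linearMap_ker_eq]
  constructor
  · intro h M _ _ _ hM hM1 f
    have hX : ∀ X : Submodule R M, (∀ g : X →ₗ[R] U, g = 0) ∧ ExtVanish R X U 1 := by
      intro X
      by_cases hX : X = ⊥
      · subst hX
        exact ⟨fun g => LinearMap.ext fun x => by rw [Subsingleton.elim x 0, map_zero, map_zero],
          extVanish_of_subsingleton 1⟩
      · exact ((h𝒳 _).1 (h (ModuleCat.of R M)
          ((h𝒳 _).2 ⟨inferInstanceAs (Module.Finite R M), hM, hM1⟩) X hX)).2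
    have h0 : ∀ f : M →ₗ[R] E, f = 0 :=
      hom_eq_zero_of_essential hη hess fun X => (hX X).1
    have h1 : LinearMap.snd R E E₁ ∘ₗ f = 0 := hessα.eq_zero _ fun X g => by
      obtain ⟨ψ, rfl⟩ := hs.exists_lift (hX X).2 g
      rw [hom_submodule_eq_zero h0 X ψ, LinearMap.comp_zero]
    ext1 x
    exact Prod.ext (LinearMap.congr_fun (h0 (LinearMap.fst R E E₁ ∘ₗ f)) x)
      (LinearMap.congr_fun h1 x)
  · intro h M hM X _
    obtain ⟨h1, h2, h2'⟩ := (h𝒳 _).1 hM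
    have h3 : ∀ f : M →ₗ[R] E, f = 0 := fun f => by
      ext x
      exact congrArg Prod.fst (LinearMap.congr_fun (h M h2 h2' (LinearMap.inl R E E₁ ∘ₗ f)) x)
    have h4 : ∀ f : M →ₗ[R] E₁, f = 0 := fun f => by
      ext x
      exact congrArg Prod.snd (LinearMap.congr_fun (h M h2 h2' (LinearMap.inr R E E₁ ∘ₗ f)) x)
    refine (h𝒳 _).2 ⟨inferInstanceAs (Module.Finite R X), fun g => ?_, ?_⟩
    · have h5 := hom_submodule_eq_zero h3 X (η ∘ₗ g)
      ext x
      exact hη ((LinearMap.congr_fun h5 x).trans (map_zero η).symm)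
    · refine hs.extVanish_coeff_left_one (extVanish_of_injective 1 le_rfl) fun φ => ⟨0, ?_⟩
      have h5 := hom_submodule_eq_zero h4 X ((LinearMap.range α).subtype ∘ₗ φ)
      ext x
      simpa using (LinearMap.congr_fun h5 x).symm

theorem injective_prod {E₁ : Type u} [AddCommGroup E₁] [Module R E₁]
    [Module.Injective R E] [Module.Injective R E₁] : Module.Injective R (E × E₁) where
  out X Y _ _ _ _ i hi f := by
    obtain ⟨g, hg⟩ := exists_extend_of_injective hi (LinearMap.fst R E E₁ ∘ₗ f)
    obtain ⟨g₁, hg₁⟩ := exists_extend_of_injective hi (LinearMap.snd R E E₁ ∘ₗ f)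
    exact ⟨g.prod g₁, fun x =>
      Prod.ext (LinearMap.congr_fun hg x) (LinearMap.congr_fun hg₁ x)⟩

theorem injective_of_extVanish (h : ∀ (W : Type u) [AddCommGroup W] [Module R W],
    ExtVanish R W E 1) : Module.Injective R E where
  out X Y _ _ _ _ i hi f := by
    obtain ⟨g, hg⟩ := (isSES_mkQ_range hi).exists_extend (h _) f
    exact ⟨g, fun x => LinearMap.congr_fun hg x⟩

/-- Injectivity gives a retraction onto `N`; its kernel meets `N` trivially, so it vanishes. -/
theorem IsEssential.eq_top_of_injective {N : Submodule R E} (hN : IsEssential R N)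
    [Module.Injective R N] : N = ⊤ := by
  obtain ⟨r, hr⟩ := exists_extend_of_injective N.subtype_injective (LinearMap.id : N →ₗ[R] N)
  have hker : LinearMap.ker r = ⊥ := by
    by_contra hk
    refine hN _ hk (eq_bot_iff.2 ?_)
    rintro x ⟨hx, hx'⟩
    have h1 := LinearMap.congr_fun hr ⟨x, hx⟩
    exact congrArg Subtype.val (h1.symm.trans hx')
  rw [eq_top_iff]
  intro x _
  have h1 : r (x - r x) = 0 := by
    have := LinearMap.congr_fun hr (r x)
    rw [map_sub, sub_eq_zero]
    exact this.symm
  have h2 : x - r x ∈ LinearMap.ker r := h1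
  rw [hker, Submodule.mem_bot, sub_eq_zero] at h2
  rw [h2]
  exact (r x).2

end Essential

/-! ### Consequences of the tilting hypotheses, on one side and on both -/

section GeneralizedTilting

variable {R : Type u} [Ring R] {U : Type u} [AddCommGroup U] [Module R U]

theorem extVanish_of_injectiveDimension_le {n : ℕ}
    (h : injectiveDimension (ModuleCat.of R U) ≤ n) (i : ℕ) (hi : n < i) (W : Type u)
    [AddCommGroup W] [Module R W] : ExtVanish R W U i := by
  have := (injectiveDimension_le_iff _ _).1 h
  exact .of_eq_zero fun x => x.eq_zero_of_hasInjectiveDimensionLT (n + 1) hi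

theorem IsGeneralizedTilting.exists_injective_pow (hU : IsGeneralizedTilting R U) :
    ∃ (k : ℕ) (j : R →ₗ[R] (Fin k → U)), Function.Injective j := by
  obtain ⟨-, -, V, η, -, hV, hη, -⟩ := hU
  obtain ⟨k, i, p, hip⟩ := hV 0
  have hi : Function.Injective i := fun x y hxy => by
    rw [← LinearMap.id_apply (R := R) x, ← LinearMap.id_apply (R := R) y, ← hip,
      LinearMap.comp_apply, LinearMap.comp_apply, hxy]
  exact ⟨k, i ∘ₗ η, hi.comp hη⟩

end GeneralizedTilting

section Bimodule

variable {R S : Type u} [Ring R] [Ring S]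
    {U : Type u} [AddCommGroup U] [Module R U] [Module Sᵐᵒᵖ U] [SMulCommClass R Sᵐᵒᵖ U]

theorem inE_iff_isExtModule (n : ℕ) (M : ModuleCat.{u} R) :
    InE R S U n M ↔ IsExtModule R Sᵐᵒᵖ U n M := Iff.rfl

omit [SMulCommClass R Sᵐᵒᵖ U] in
theorem IsEndRing.existsUnique (hS : IsEndRing R S U) (φ : U →ₗ[R] U) :
    ∃! b : Sᵐᵒᵖ, ∀ x, φ x = b • x := by
  obtain ⟨s, hs, hs'⟩ := hS φ
  exact ⟨MulOpposite.op s, hs, fun b hb => by rw [← hs' b.unop hb, MulOpposite.op_unop]⟩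

/-- A generalized tilting module of injective dimension at most two on both sides is dualizing on
both sides. -/
theorem IsGeneralizedTilting.isDualizing [SMulCommClass Sᵐᵒᵖ R U]
    (hU : IsGeneralizedTilting R U) (hS : IsEndRing R S U)
    (hR2 : injectiveDimension (ModuleCat.of R U) ≤ (2 : ℕ))
    (hS2 : injectiveDimension (ModuleCat.of Sᵐᵒᵖ U) ≤ (2 : ℕ)) :
    IsDualizing R Sᵐᵒᵖ U ∧ IsDualizing Sᵐᵒᵖ R U ∧ Module.Finite Sᵐᵒᵖ U := by
  obtain ⟨hself, -, V, η, δ, hV, hη, hηδ, hδ, hη', hηδ', hδ'⟩ := hU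
  have hB := hS.existsUnique
  obtain ⟨h1, h2, h3, h4⟩ := selforthogonal_and_end_of_coresolution hB V η δ hV hη hηδ hδ
    hη' hηδ' hδ'
  refine ⟨⟨h2, h3, h4, fun i hi => extVanish_of_injectiveDimension_le hS2 i hi⟩,
    ⟨fun φ => (hB φ).exists, fun b hb => ?_, hself,
      fun i hi => extVanish_of_injectiveDimension_le hR2 i hi⟩, h1⟩
  exact (hB 0).unique (fun x => (hb x).symm) fun x => (zero_smul _ x).symm

end Bimodule

end WakamatsuTilting

end

/-! ### The proposition -/

open WakamatsuTilting in
theorem proposition3p13 (R S : Type u) [Ring R] [Ring S]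
    [IsNoetherianRing R] [IsNoetherianRing Sᵐᵒᵖ]
    (U : Type u) [AddCommGroup U] [Module R U] [Module Sᵐᵒᵖ U] [SMulCommClass R Sᵐᵒᵖ U]
    (hU : WakamatsuTilting.IsGeneralizedTilting R U) (hS : WakamatsuTilting.IsEndRing R S U)
    (E : ℕ → ModuleCat.{u} R) (η : U →ₗ[R] E 0) (α : ∀ i, E i →ₗ[R] E (i + 1))
    (hE : WakamatsuTilting.IsMinimalInjectiveResolution R U E η α)
    (n : ℕ) (hn : n ≤ 2)
    (hid : injectiveDimension (ModuleCat.of R U) = injectiveDimension (ModuleCat.of Sᵐᵒᵖ U))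
    (hidn : injectiveDimension (ModuleCat.of R U) ≤ n) :
    (n = 1 →
      (WakamatsuTilting.SubmoduleClosed R (WakamatsuTilting.InE R S U 1) ↔
        WakamatsuTilting.InAddLim R U (E 0)) ∧
      (WakamatsuTilting.InAddLim R U (E 0) ↔ WakamatsuTilting.limDim R U (E 0) = 0) ∧
      (WakamatsuTilting.InAddLim R U (E 0) ↔
        WakamatsuTilting.limDim R U (E 0) ≤ 0 ∧ WakamatsuTilting.limDim R U (E 1) ≤ 1)) ∧
    (n = 2 →
      (WakamatsuTilting.SubmoduleClosed R (WakamatsuTilting.InE R S U 2) ↔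
        WakamatsuTilting.limDim R U (E 0 × E 1) ≤ 1)) := by
  have hcomm : SMulCommClass Sᵐᵒᵖ R U := SMulCommClass.symm _ _ _
  have hle : ((n : ℕ∞) : WithBot ℕ∞) ≤ ((2 : ℕ) : ℕ∞) := by exact_mod_cast hn
  have hR2 : injectiveDimension (ModuleCat.of R U) ≤ (2 : ℕ) := hidn.trans hle
  have hSn : injectiveDimension (ModuleCat.of Sᵐᵒᵖ U) ≤ n := hid ▸ hidn
  have hS2 : injectiveDimension (ModuleCat.of Sᵐᵒᵖ U) ≤ (2 : ℕ) := hSn.trans hle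
  obtain ⟨hR, hS', hfS⟩ := hU.isDualizing hS hR2 hS2
  have hfR : Module.Finite R U := hU.2.1.1
  have hE0 := hE.injective 0
  have hE1 := hE.injective 1
  have hz : limDim R U (E 0) = 0 ↔ limDim R U (E 0) ≤ 0 := nonpos_iff_eq_zero.symm
  have hself : ExtVanish R U U 1 := hS'.extVanish_self 1 le_rfl
  constructor
  · rintro rfl
    have hid2 : ∀ (W : Type u) [AddCommGroup W] [Module R W], ExtVanish R W U 2 :=
      extVanish_of_injectiveDimension_le hidn 2 (by lia)
    have hclass : ∀ M, InE R S U 1 M ↔ Module.Finite R M ∧ ∀ g : M →ₗ[R] U, g = 0 := fun M => by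
      rw [inE_iff_isExtModule]
      constructor
      · exact fun h => ⟨h.1, h.one_hom_eq_zero hS'
          (extVanish_of_injectiveDimension_le hSn 2 (by lia))⟩
      · rintro ⟨h1, h2⟩
        exact isExtModule_one hR (hid2 M) h2
    refine ⟨?_, by rw [hz, limDim_le_zero_iff], ?_⟩
    · rw [submoduleClosed_one_iff hclass hE.mono hE.essential_zero, inAddLim_iff]
      exact ⟨factorsOnFinite_of_hom_eq_zero (B := Sᵐᵒᵖ) hself hid2,
        fun h M _ _ _ hM f => h.hom_eq_zero hM f⟩
    · rw [limDim_le_zero_iff]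
      refine ⟨fun h => ⟨h, ?_⟩, fun h => h.1⟩
      have hs : IsSES η (α 0).rangeRestrict := by
        refine ⟨hE.mono, ?_, (α 0).surjective_rangeRestrict⟩
        rw [LinearMap.exact_iff, LinearMap.ker_rangeRestrict, hE.exact_zero.linearMap_ker_eq]
      -- Injective dimension at most one makes the image of `α 0` injective; being essential, it is
      -- all of `E 1`. Thus `0 → U → E 0 → E 1 → 0` is already a resolution of `E 1` in `add-lim U`.
      have hinj : Module.Injective R (LinearMap.range (α 0)) := injective_of_extVanish fun W _ _ =>
        hs.extVanish_coeff_right (extVanish_of_injective 1 le_rfl) (hid2 W)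
      have htop := (hE.essential_succ 0).eq_top_of_injective
      exact limDim_le_one_iff.2 ⟨ModuleCat.of R U, E 0, η, α 0,
        ⟨hE.mono, hE.exact_zero, LinearMap.range_eq_top.1 htop⟩, factorsOnFinite_self,
        h.factorsOnFinite⟩
  · rintro rfl
    have hclass : ∀ M, InE R S U 2 M ↔
        Module.Finite R M ∧ (∀ g : M →ₗ[R] U, g = 0) ∧ ExtVanish R M U 1 := fun M => by
      rw [inE_iff_isExtModule]
      constructor
      · exact fun h => ⟨h.1, h.two_hom_eq_zero hR hS'⟩
      · rintro ⟨h1, h2, h3⟩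
        exact isExtModule_two hR h3 h2
    have hE01 : Module.Injective R (E 0 × E 1) := injective_prod
    rw [submoduleClosed_two_iff hclass hE.mono hE.essential_zero hE.exact_zero
      (hE.essential_succ 0), limDim_le_one_iff]
    constructor
    · intro h
      obtain ⟨k, j, hj⟩ := hU.exists_injective_pow
      exact ⟨ModuleCat.of R (LinearMap.ker (evalSum R U (E 0 × E 1))),
        ModuleCat.of R ((U →ₗ[R] E 0 × E 1) →₀ U),
        (LinearMap.ker (evalSum R U (E 0 × E 1))).subtype, evalSum R U (E 0 × E 1),
        isSES_ker_subtype (evalSum_surjective hj), factorsOnFinite_ker_evalSum hR hS' h,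
        factorsOnFinite_finsupp _⟩
    · rintro ⟨V₁, V₀, d, ε, h, h1, h0⟩ M _ _ _ hM hM1 f
      exact hom_eq_zero_of_isSES h h1 h0 hM hM1 f
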